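/- Let $(M,g)$ be an $n$-dimensional smooth Riemannian manifold with Levi-Civita connection $\nabla^{LC}$, let $f\colon M\to\mathbb R$ be smooth, and let $\iota\colon M\to\mathbb R^{\tilde n}$ be a smooth conformal immersion into Euclidean space with $\iota^*\langle\cdot,\cdot\rangle=e^{2f}g$. Let $NM$ be the normal bundle, $NM_x=(d\iota(T_xM))^\perp\subset\mathbb R^{\tilde n}$, with the metric $\langle\cdot,\cdot\rangle$ and the normal connection $\nabla^\perp$ (the normal part of the flat derivative of $\mathbb R^{\tilde n}$), and let $\overline\Pi(X,Y)$ be the second fundamental form of $\iota$ (the normal part of the flat derivative of $d\iota(Y)$ along $X$), i.e. that of the isometric immersion $(M,e^{2f}g)\to\mathbb R^{\tilde n}$. With $\nabla f$ and $\mathrm{Hess}(f)$ the gradient and the Hessian of $f$ with respect to $g$, put $$\Pi=e^{-f}\,\overline\Pi,\qquad B=\mathrm{Hess}(f)-df\otimes df+\tfrac12 g(\nabla f,\nabla f)\,g,\qquad D=e^{-f}\,\overline\Pi(\nabla f,\cdot).$$ Let $R_{XY}=\nabla_X\nabla_Y-\nabla_Y\nabla_X-\nabla_{[X,Y]}$ be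 the curvature of the connection $\nabla=\nabla^{LC}+\nabla^\perp$ on $TM\oplus NM$, denote by $\nabla$ also the induced covariant derivative of tensors, put $D_\flat(Y,\mu)=\langle D(Y),\mu\rangle$, and let $$(g\circledast B)(X,Y,Z,W)=g(X,Z)B(Y,W)+g(Y,W)B(X,Z)-g(X,W)B(Y,Z)-g(Y,Z)B(X,W)$$ be the Kulkarni–Nomizu product. Then for all smooth vector fields $X,Y,Z,W$ on $M$, all smooth sections $\mu,\nu$ of $NM$, and every smooth local $g$-orthonormal frame field $(e_i)_{i=1}^n$ of $(M,g)$ (on whose domain the equations with sums hold): 1. (Gauss) $g(R_{XY}Z,W)-\langle\Pi(Y,Z),\Pi(X,W)\rangle+\langle\Pi(X,Z),\Pi(Y,W)\rangle=-(g\circledast B)(X,Y,Z,W)$; 2. (Codazzi) $(\nabla_X\Pi)(Y,Z)-(\nabla_Y\Pi)(X,Z)=g(Y,Z)\,D(X)-g(X,Z)\,D(Y)$; 3. (Ricci) $\langle R_{XY}\mu,\nu\rangle+\sum_{i=1}^n\langle\Pi(X,e_i),\mu\rangle\langle\Pi(Y,e_i),\nu\rangle-\sum_{i=1}^n\langle\Pi(X,e_i),\nu\rangle\langle\Pi(Y,e_i),\mu\rangle=0$;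 4. $(\nabla_XB)(Y,Z)+\langle D(X),\Pi(Y,Z)\rangle$ is symmetric in $X,Y$; 5. $(\nabla_XD_\flat)(Y,\mu)+\sum_{i=1}^n\langle\Pi(X,e_i),\mu\rangle B(Y,e_i)$ is symmetric in $X,Y$. -/

import Mathlib

open scoped Manifold ContDiff InnerProductSpace
open Bundle

noncomputable section

namespace ConformalImmersion

/-- A (not necessarily smooth) vector field on a manifold `M` modelled on `ℝⁿ`. -/
abbrev VField (n : ℕ) (M : Type*) [TopologicalSpace M] [ChartedSpace (EuclideanSpace ℝ (Fin n)) M] :=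
  (x : M) → TangentSpace (𝓡 n) x

/-- Smooth Riemannian metrics on `M`. -/
abbrev RiemMetric (n : ℕ) (M : Type*) [TopologicalSpace M]
    [ChartedSpace (EuclideanSpace ℝ (Fin n)) M] [IsManifold (𝓡 n) ∞ M] :=
  ContMDiffRiemannianMetric (𝓡 n) ∞ (EuclideanSpace ℝ (Fin n))
    (fun x : M => TangentSpace (𝓡 n) x)

section General

variable {n : ℕ} {M : Type*} [TopologicalSpace M] [ChartedSpace (EuclideanSpace ℝ (Fin n)) M]

/-- Smoothness of a vector field on a subset of `M`. -/
def SmoothFieldOn [IsManifold (𝓡 n) ∞ M] (X : VField n M) (U : Set M) : Prop :=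
  ContMDiffOn (𝓡 n) (𝓡 n).tangent ∞ (fun x => (⟨x, X x⟩ : TangentBundle (𝓡 n) M)) U

/-- Smoothness of a vector field on all of `M`. -/
def SmoothField [IsManifold (𝓡 n) ∞ M] (X : VField n M) : Prop :=
  ContMDiff (𝓡 n) (𝓡 n).tangent ∞ (fun x => (⟨x, X x⟩ : TangentBundle (𝓡 n) M))

/-- The derivative `X(h) = dh(X)` of a function `h : M → F`, `F` a normed space, along a vector
field `X`. -/
def dirDeriv {F : Type*} [NormedAddCommGroup F] [NormedSpace ℝ F]
    (X : VField n M) (h : M → F) : M → F :=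
  fun x => mfderiv (𝓡 n) 𝓘(ℝ, F) h x (X x)

/-- Curvature `R_{XY} s = ∇_X ∇_Y s - ∇_Y ∇_X s - ∇_{[X,Y]} s` of an operator `∇_X s`, where `X`
is a vector field and `s` lies in a space of sections. -/
def curvature {S : Type*} [AddCommGroup S] (nabla : VField n M → S → S) (X Y : VField n M)
    (s : S) : S :=
  nabla X (nabla Y s) - nabla Y (nabla X s) - nabla (VectorField.mlieBracket (𝓡 n) X Y) s

/-- The direct sum of two connections, acting on pairs of sections. -/
def directSum {S T : Type*} (nabla : VField n M → S → S) (nabla' : VField n M → T → T) :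
    VField n M → S × T → S × T :=
  fun X s => (nabla X s.1, nabla' X s.2)

/-- The covariant derivative of a tensor with two arguments (regarded as a bilinear map on
sections), induced by connections on the bundles of the arguments and of the values:
`(∇_X τ)(a, b) = ∇_X (τ(a, b)) - τ(∇_X a, b) - τ(a, ∇_X b)`. -/
def covDerivTensor {S T V : Type*} [AddCommGroup V] (nablaS : VField n M → S → S)
    (nablaT : VField n M → T → T) (nablaV : VField n M → V → V) (τ : S → T → V)
    (X : VField n M) (a : S) (b : T) : V :=
  nablaV X (τ a b) - τ (nablaS X a) b - τ a (nablaT X b)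

/-- The Kulkarni–Nomizu product of two symmetric `(0,2)`-tensors. -/
def kulkarniNomizu (b b' : VField n M → VField n M → M → ℝ) (X Y Z W : VField n M) : M → ℝ :=
  b X Z * b' Y W + b Y W * b' X Z - b X W * b' Y Z - b Y Z * b' X W

end General

section Riemannian

variable {n : ℕ} {M : Type*} [TopologicalSpace M] [ChartedSpace (EuclideanSpace ℝ (Fin n)) M]
  [IsManifold (𝓡 n) ∞ M]

/-- The function `g(X, Y)`. -/
def RiemMetric.pair (g : RiemMetric n M) (X Y : VField n M) : M → ℝ :=
  fun x => g.inner x (X x) (Y x)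

/-- The scalar product `g_x`, as an algebraic bilinear form. -/
def RiemMetric.bilin (g : RiemMetric n M) (x : M) : LinearMap.BilinForm ℝ (TangentSpace (𝓡 n) x) :=
  LinearMap.mk₂ ℝ (fun v w => g.inner x v w) (by simp) (by simp) (by simp) (by simp)

theorem RiemMetric.bilin_nondegenerate (g : RiemMetric n M) (x : M) : (g.bilin x).Nondegenerate := by
  constructor
  · intro v hv
    by_contra h
    exact (g.pos x v h).ne' (hv v)
  · intro v hv
    by_contra h
    exact (g.pos x v h).ne' (hv v)

instance (x : M) : FiniteDimensional ℝ (TangentSpace (𝓡 n) x) :=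
  inferInstanceAs (FiniteDimensional ℝ (EuclideanSpace ℝ (Fin n)))

/-- The vector `v` in `T_x M` with `g(v, w) = α(w)` for all `w`. -/
def RiemMetric.sharp (g : RiemMetric n M) (x : M) (α : Module.Dual ℝ (TangentSpace (𝓡 n) x)) :
    TangentSpace (𝓡 n) x :=
  ((g.bilin x).toDual (g.bilin_nondegenerate x)).symm α

theorem RiemMetric.inner_sharp (g : RiemMetric n M) (x : M)
    (α : Module.Dual ℝ (TangentSpace (𝓡 n) x)) (w : TangentSpace (𝓡 n) x) :
    g.inner x (g.sharp x α) w = α w :=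
  LinearMap.BilinForm.apply_toDual_symm_apply (hB := g.bilin_nondegenerate x) α w

/-- The gradient of `f` with respect to `g`. -/
def RiemMetric.gradient (g : RiemMetric n M) (f : M → ℝ) : VField n M :=
  fun x => g.sharp x (mfderiv (𝓡 n) 𝓘(ℝ, ℝ) f x : TangentSpace (𝓡 n) x →L[ℝ] ℝ).toLinearMap

/-- Right-hand side of the Koszul formula for `g(∇_X Y, W)`. -/
def RiemMetric.koszul (g : RiemMetric n M) (X Y W : VField n M) : M → ℝ :=
  (1 / 2 : ℝ) • (dirDeriv X (g.pair Y W) + dirDeriv Y (g.pair X W) - dirDeriv W (g.pair X Y)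
    + g.pair (VectorField.mlieBracket (𝓡 n) X Y) W
    - g.pair (VectorField.mlieBracket (𝓡 n) X W) Y
    - g.pair (VectorField.mlieBracket (𝓡 n) Y W) X)

/-- The standard basis of `T_x M`, which is a copy of `ℝⁿ` through the preferred chart at `x`. -/
def stdBasis (x : M) : Module.Basis (Fin n) ℝ (TangentSpace (𝓡 n) x) :=
  (EuclideanSpace.basisFun (Fin n) ℝ).toBasis

/-- The Levi-Civita connection of `g`: at a point `x`, `∇_X Y` is the vector whose scalar products
with the vectors `w` of a basis of `T_x M` are given by the Koszul formula, `w` being extended to a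
vector field `W` near `x`. (For smooth `X`, `Y` the Koszul expression is tensorial in `W`, so
neither the basis nor the extensions matter.) -/
def RiemMetric.leviCivita (g : RiemMetric n M) (X Y : VField n M) : VField n M :=
  fun x => g.sharp x ((stdBasis x).constr ℝ fun i =>
    g.koszul X Y (FiberBundle.extend (EuclideanSpace ℝ (Fin n)) (stdBasis x i)) x)

/-- The Hessian of `f` with respect to `g`: `Hess f (X, Y) = X(Y f) - (∇_X Y) f`. -/
def RiemMetric.hessian (g : RiemMetric n M) (f : M → ℝ) (X Y : VField n M) : M → ℝ :=
  dirDeriv X (dirDeriv Y f) - dirDeriv (g.leviCivita X Y) f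

/-- The tensor `B = Hess f - df ⊗ df + ½ g(∇f, ∇f) g`. -/
def tensorB (g : RiemMetric n M) (f : M → ℝ) (X Y : VField n M) : M → ℝ :=
  g.hessian f X Y - dirDeriv X f * dirDeriv Y f
    + (1 / 2 : ℝ) • (g.pair (g.gradient f) (g.gradient f) * g.pair X Y)

/-- `e` is a smooth orthonormal frame field of `(M, g)` on the open set `U`. -/
structure RiemMetric.IsOrthonormalFrameOn (g : RiemMetric n M) (e : Fin n → VField n M) (U : Set M) :
    Prop where
  isOpen : IsOpen U
  smooth : ∀ i, SmoothFieldOn (e i) U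
  orthonormal : ∀ x ∈ U, ∀ i j, g.inner x (e i x) (e j x) = if i = j then 1 else 0

end Riemannian

section Extrinsic

variable {n m : ℕ} {M : Type*} [TopologicalSpace M] [ChartedSpace (EuclideanSpace ℝ (Fin n)) M]

/-- The differential of a map `ι : M → ℝᵐ` at `x`. -/
def differential (ι : M → EuclideanSpace ℝ (Fin m)) (x : M) :
    TangentSpace (𝓡 n) x →L[ℝ] EuclideanSpace ℝ (Fin m) :=
  mfderiv (𝓡 n) 𝓘(ℝ, EuclideanSpace ℝ (Fin m)) ι x

/-- The normal space of `ι` at `x`, the orthogonal complement of `dι(T_x M)` in `ℝᵐ`. -/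
def normalSpace (ι : M → EuclideanSpace ℝ (Fin m)) (x : M) :
    Submodule ℝ (EuclideanSpace ℝ (Fin m)) :=
  (LinearMap.range (differential (n := n) ι x).toLinearMap)ᗮ

/-- Smooth sections of the normal bundle `NM` of `ι`, as maps to `ℝᵐ`. -/
structure IsNormalSection (ι μ : M → EuclideanSpace ℝ (Fin m)) : Prop where
  smooth : ContMDiff (𝓡 n) 𝓘(ℝ, EuclideanSpace ℝ (Fin m)) ∞ μ
  mem : ∀ x, μ x ∈ normalSpace (n := n) ι x

/-- The connection on the normal bundle: the normal part of the flat derivative of `ℝᵐ`. -/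
def normalConnection (ι : M → EuclideanSpace ℝ (Fin m)) (X : VField n M)
    (μ : M → EuclideanSpace ℝ (Fin m)) : M → EuclideanSpace ℝ (Fin m) :=
  fun x => (normalSpace (n := n) ι x).starProjection (dirDeriv X μ x)

/-- The second fundamental form of `ι`: the normal part of the flat derivative of `dι(Y)`
along `X`. -/
def secondFundamentalForm (ι : M → EuclideanSpace ℝ (Fin m)) (X Y : VField n M) :
    M → EuclideanSpace ℝ (Fin m) :=
  fun x => (normalSpace (n := n) ι x).starProjection
    (dirDeriv X (fun y => differential ι y (Y y)) x)

/-- The tensor `Π = e^{-f} Π̄`. -/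
def tensorPi (ι : M → EuclideanSpace ℝ (Fin m)) (f : M → ℝ) (X Y : VField n M) :
    M → EuclideanSpace ℝ (Fin m) :=
  fun x => Real.exp (-f x) • secondFundamentalForm ι X Y x

/-- The tensor `D = e^{-f} Π̄(∇f, ·)`, the gradient being taken with respect to `g`. -/
def tensorD [IsManifold (𝓡 n) ∞ M] (g : RiemMetric n M) (ι : M → EuclideanSpace ℝ (Fin m))
    (f : M → ℝ) (X : VField n M) : M → EuclideanSpace ℝ (Fin m) :=
  fun x => Real.exp (-f x) • secondFundamentalForm ι (g.gradient f) X x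

/-- The tensor `♭ ∘ D`, `(Y, μ) ↦ ⟨D(Y), μ⟩`. -/
def tensorDFlat [IsManifold (𝓡 n) ∞ M] (g : RiemMetric n M) (ι : M → EuclideanSpace ℝ (Fin m))
    (f : M → ℝ) (Y : VField n M) (μ : M → EuclideanSpace ℝ (Fin m)) : M → ℝ :=
  fun x => ⟪tensorD g ι f Y x, μ x⟫_ℝ

/-- `ι` is a conformal immersion of `(M, g)` into `ℝᵐ` with `ι^*⟨·,·⟩ = e^{2f} g`. (The second
condition forces all differentials of `ι` to be injective.) -/
structure IsConformalImmersion [IsManifold (𝓡 n) ∞ M] (g : RiemMetric n M)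
    (ι : M → EuclideanSpace ℝ (Fin m)) (f : M → ℝ) : Prop where
  smooth : ContMDiff (𝓡 n) 𝓘(ℝ, EuclideanSpace ℝ (Fin m)) ∞ ι
  pullback : ∀ (x : M) (v w : TangentSpace (𝓡 n) x),
    ⟪differential ι x v, differential ι x w⟫_ℝ = Real.exp (2 * f x) * g.inner x v w

/-- The connection `∇ = ∇^{LC} ⊕ ∇^⊥` on `TM ⊕ NM`. -/
def sumConnection [IsManifold (𝓡 n) ∞ M] (g : RiemMetric n M) (ι : M → EuclideanSpace ℝ (Fin m)) :
    VField n M → VField n M × (M → EuclideanSpace ℝ (Fin m)) →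
      VField n M × (M → EuclideanSpace ℝ (Fin m)) :=
  directSum g.leviCivita (normalConnection ι)

/-- The curvature `R` of the connection `∇ = ∇^{LC} ⊕ ∇^⊥` on `TM ⊕ NM`. -/
def totalCurvature [IsManifold (𝓡 n) ∞ M] (g : RiemMetric n M) (ι : M → EuclideanSpace ℝ (Fin m))
    (X Y : VField n M) (s : VField n M × (M → EuclideanSpace ℝ (Fin m))) :
    VField n M × (M → EuclideanSpace ℝ (Fin m)) :=
  curvature (sumConnection g ι) X Y s

/-- `(∇_X Π)(Y, Z)`. -/
def nablaPi [IsManifold (𝓡 n) ∞ M] (g : RiemMetric n M) (ι : M → EuclideanSpace ℝ (Fin m))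
    (f : M → ℝ) (X Y Z : VField n M) : M → EuclideanSpace ℝ (Fin m) :=
  covDerivTensor g.leviCivita g.leviCivita (normalConnection ι) (tensorPi ι f) X Y Z

/-- `(∇_X B)(Y, Z)`. -/
def nablaB [IsManifold (𝓡 n) ∞ M] (g : RiemMetric n M) (f : M → ℝ) (X Y Z : VField n M) : M → ℝ :=
  covDerivTensor g.leviCivita g.leviCivita dirDeriv (tensorB g f) X Y Z

/-- `(∇_X (♭ ∘ D))(Y, μ)`. -/
def nablaDFlat [IsManifold (𝓡 n) ∞ M] (g : RiemMetric n M) (ι : M → EuclideanSpace ℝ (Fin m))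
    (f : M → ℝ) (X Y : VField n M) (μ : M → EuclideanSpace ℝ (Fin m)) : M → ℝ :=
  covDerivTensor g.leviCivita (normalConnection ι) dirDeriv (tensorDFlat g ι f) X Y μ

end Extrinsic

end ConformalImmersion

end

open ConformalImmersion

/-!
Put `T = e^{-f} dι`. By the conformality condition `T` is an isometry from `(T_xM, g_x)` onto the
tangent space of `ι` in `ℝᵐ`, so all equations are read off from the flat derivative of `ℝᵐ`.

The starting point is `dirDeriv_push_eq`:
`∂_X(T Y) = T(∇_X Y + df(Y) X - g(X, Y) ∇f) + Π(X, Y)`.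
Its normal part is the definition of `Π`. For its tangential part, the Koszul expression is computed
from `g(X, Y) = ⟨TX, TY⟩` and from the fact that `∂_X(TY) - ∂_Y(TX)` is `T[X, Y]` up to
derivatives of `f` (`koszul_eq`); since the result is linear in the value of the test field at the
point, it determines the Levi-Civita connection (`inner_leviCivita`).

The flat derivative satisfies `∂_X ∂_Y h - ∂_Y ∂_X h = ∂_{[X, Y]} h` for vector valued functions
(`dirDeriv_mlieBracket`, proved in a chart). With `h = T Z` the tangential part of this identity is
the Gauss equation, where the terms in `f` add up to the Kulkarni–Nomizu product `g ⊛ B`, and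
the normal part is the Codazzi equation. With `h = μ` a normal field, the normal part is the Ricci
equation, the tangential parts of `∂_X μ` and `∂_Y μ` contributing the shape operators.

The last two equations are the first two with `Z = ∇f`. From `Hess f (X, Y) = g(∇_X ∇f, Y)` one
finds `(∇_X B)(Y, Z) - (∇_Y B)(X, Z) = g(R_{XY} ∇f, Z) + (g ⊛ B)(X, Y, ∇f, Z)`, to which the Gauss
equation applies. Likewise `D_♭(Y, μ) = ⟨Π(Y, ∇f), μ⟩`, so that the antisymmetric part of its
covariant derivative is given by the Codazzi equation and `Π(Y, ∇_X ∇f) - Π(X, ∇_Y ∇f)`, which the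
contraction of `Π` with `B` cancels.

Second derivatives require the fields `∇f`, `∇_X Y` and the tangential parts to be smooth. This
is `smoothFieldAt_of_pair`: a field is smooth if its scalar products with smooth fields are.
-/

noncomputable section

namespace ConformalImmersion

/-! ### Derivatives along vector fields and the Lie bracket -/

section Calculus

variable {n : ℕ} {M : Type*} [TopologicalSpace M] [ChartedSpace (EuclideanSpace ℝ (Fin n)) M]
  {F F₁ F₂ F₃ : Type*} [NormedAddCommGroup F] [NormedSpace ℝ F]
  [NormedAddCommGroup F₁] [NormedSpace ℝ F₁] [NormedAddCommGroup F₂] [NormedSpace ℝ F₂]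
  [NormedAddCommGroup F₃] [NormedSpace ℝ F₃] {x : M}

/-- A function on `M` with values in a normed space is smooth at a point. -/
abbrev SmoothAt (n : ℕ) {M : Type*} [TopologicalSpace M]
    [ChartedSpace (EuclideanSpace ℝ (Fin n)) M] {F : Type*} [NormedAddCommGroup F]
    [NormedSpace ℝ F] (h : M → F) (x : M) : Prop :=
  ContMDiffAt (𝓡 n) 𝓘(ℝ, F) ∞ h x

/-- A vector field on `M` is smooth at a point. -/
def SmoothFieldAt [IsManifold (𝓡 n) ∞ M] (X : VField n M) (x : M) : Prop :=
  ContMDiffAt (𝓡 n) (𝓡 n).tangent ∞ (fun x => (⟨x, X x⟩ : TangentBundle (𝓡 n) M)) x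

theorem SmoothField.at [IsManifold (𝓡 n) ∞ M] {X : VField n M} (hX : SmoothField X) (x : M) :
    SmoothFieldAt X x := hX x

theorem SmoothAt.mdiff {h : M → F} (hh : SmoothAt n h x) :
    MDifferentiableAt (𝓡 n) 𝓘(ℝ, F) h x := ContMDiffAt.mdifferentiableAt hh (by simp)

theorem hasMFDerivAt_bilin (B : F₁ →L[ℝ] F₂ →L[ℝ] F₃) {a : M → F₁} {b : M → F₂}
    {a' : TangentSpace (𝓡 n) x →L[ℝ] F₁} {b' : TangentSpace (𝓡 n) x →L[ℝ] F₂}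
    (ha : HasMFDerivAt (𝓡 n) 𝓘(ℝ, F₁) a x a') (hb : HasMFDerivAt (𝓡 n) 𝓘(ℝ, F₂) b x b') :
    HasMFDerivAt (𝓡 n) 𝓘(ℝ, F₃) (fun y => B (a y) (b y)) x
      (B.precompR (EuclideanSpace ℝ (Fin n)) (a x) b' +
        B.precompL (EuclideanSpace ℝ (Fin n)) a' (b x)) := by
  refine ⟨(B.continuous₂.tendsto (a x, b x)).comp (ha.1.prodMk_nhds hb.1), ?_⟩
  simpa only [mfld_simps] using! B.hasFDerivWithinAt_of_bilinear ha.2 hb.2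

theorem dirDeriv_bilin (B : F₁ →L[ℝ] F₂ →L[ℝ] F₃) (X : VField n M) {a : M → F₁} {b : M → F₂}
    (ha : SmoothAt n a x) (hb : SmoothAt n b x) :
    dirDeriv X (fun y => B (a y) (b y)) x
      = B (dirDeriv X a x) (b x) + B (a x) (dirDeriv X b x) := by
  have h := (hasMFDerivAt_bilin B ha.mdiff.hasMFDerivAt hb.mdiff.hasMFDerivAt).mfderiv
  unfold dirDeriv
  rw [h, add_comm]
  rfl

theorem SmoothAt.bilin (B : F₁ →L[ℝ] F₂ →L[ℝ] F₃) {a : M → F₁} {b : M → F₂}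
    (ha : SmoothAt n a x) (hb : SmoothAt n b x) : SmoothAt n (fun y => B (a y) (b y)) x :=
  ((B.contDiff.contMDiff.contMDiffAt).comp x ha).clm_apply hb

theorem SmoothAt.smul {a : M → ℝ} {h : M → F} (ha : SmoothAt n a x) (hh : SmoothAt n h x) :
    SmoothAt n (fun y => a y • h y) x := ContMDiffAt.smul ha hh

theorem SmoothAt.mul {a b : M → ℝ} (ha : SmoothAt n a x) (hb : SmoothAt n b x) :
    SmoothAt n (fun y => a y * b y) x := ha.smul hb

theorem SmoothAt.add {a b : M → F} (ha : SmoothAt n a x) (hb : SmoothAt n b x) :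
    SmoothAt n (fun y => a y + b y) x := ContMDiffAt.add ha hb

theorem SmoothAt.sub {a b : M → F} (ha : SmoothAt n a x) (hb : SmoothAt n b x) :
    SmoothAt n (fun y => a y - b y) x := ContMDiffAt.sub ha hb

theorem SmoothAt.inner {E : Type*} [NormedAddCommGroup E] [InnerProductSpace ℝ E] {a b : M → E}
    (ha : SmoothAt n a x) (hb : SmoothAt n b x) : SmoothAt n (fun y => ⟪a y, b y⟫_ℝ) x :=
  SmoothAt.bilin (innerSL ℝ) ha hb

theorem dirDeriv_smul (X : VField n M) {a : M → ℝ} {h : M → F} (ha : SmoothAt n a x)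
    (hh : SmoothAt n h x) :
    dirDeriv X (fun y => a y • h y) x = dirDeriv X a x • h x + a x • dirDeriv X h x :=
  dirDeriv_bilin (ContinuousLinearMap.lsmul ℝ ℝ) X ha hh

theorem dirDeriv_mul (X : VField n M) {a b : M → ℝ} (ha : SmoothAt n a x)
    (hb : SmoothAt n b x) :
    dirDeriv X (fun y => a y * b y) x = dirDeriv X a x * b x + a x * dirDeriv X b x :=
  dirDeriv_smul X ha hb

theorem dirDeriv_inner {E : Type*} [NormedAddCommGroup E] [InnerProductSpace ℝ E]
    (X : VField n M) {a b : M → E} (ha : SmoothAt n a x) (hb : SmoothAt n b x) :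
    dirDeriv X (fun y => ⟪a y, b y⟫_ℝ) x
      = ⟪dirDeriv X a x, b x⟫_ℝ + ⟪a x, dirDeriv X b x⟫_ℝ :=
  dirDeriv_bilin (innerSL ℝ) X ha hb

theorem dirDeriv_add (X : VField n M) {a b : M → F} (ha : SmoothAt n a x)
    (hb : SmoothAt n b x) :
    dirDeriv X (fun y => a y + b y) x = dirDeriv X a x + dirDeriv X b x := by
  unfold dirDeriv
  erw [mfderiv_add ha.mdiff hb.mdiff]
  rfl

theorem dirDeriv_sub (X : VField n M) {a b : M → F} (ha : SmoothAt n a x)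
    (hb : SmoothAt n b x) :
    dirDeriv X (fun y => a y - b y) x = dirDeriv X a x - dirDeriv X b x := by
  unfold dirDeriv
  erw [mfderiv_sub ha.mdiff hb.mdiff]
  rfl

theorem dirDeriv_const (X : VField n M) (c : F) : dirDeriv X (fun _ => c) x = 0 := by
  unfold dirDeriv
  rw [mfderiv_const]
  rfl

theorem dirDeriv_exp_neg (X : VField n M) {f : M → ℝ} (hf : SmoothAt n f x) :
    dirDeriv X (fun y => Real.exp (-f y)) x = -(Real.exp (-f x) * dirDeriv X f x) := by
  have hd : HasDerivAt (fun t : ℝ => Real.exp (-t)) (-Real.exp (-f x)) (f x) := by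
    simpa using (hasDerivAt_neg (f x)).exp
  have h := (hd.hasFDerivAt.hasMFDerivAt.comp x hf.mdiff.hasMFDerivAt).mfderiv
  unfold dirDeriv
  erw [h]
  change @Eq ℝ (dirDeriv X f x * (-Real.exp (-f x))) (-(Real.exp (-f x) * dirDeriv X f x))
  ring

theorem SmoothAt.exp_neg {f : M → ℝ} (hf : SmoothAt n f x) :
    SmoothAt n (fun y => Real.exp (-f y)) x :=
  (Real.contDiff_exp.comp contDiff_neg).contMDiff.contMDiffAt.comp x hf

theorem SmoothFieldAt.dirDeriv [IsManifold (𝓡 n) ∞ M] {X : VField n M} {h : M → F}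
    (hX : SmoothFieldAt X x) (hh : SmoothAt n h x) : SmoothAt n (dirDeriv X h) x := by
  have h1 := hh.mfderiv_const (m := ∞) (by simp)
  have h2 := ContMDiffAt.clm_apply_of_inCoordinates h1 hX hh
  exact (contMDiff_snd_tangentBundle_modelSpace F 𝓘(ℝ, F)).contMDiffAt.comp x h2

/-- A vector field read in the extended chart at `x`, as a vector field on the model space; this
is the field entering Mathlib's definition of the Lie bracket. -/
def chartField (X : VField n M) (x : M) :
    EuclideanSpace ℝ (Fin n) → EuclideanSpace ℝ (Fin n) :=
  VectorField.mpullbackWithin 𝓘(ℝ, EuclideanSpace ℝ (Fin n)) (𝓡 n)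
    (extChartAt (𝓡 n) x).symm X (Set.range (𝓡 n))

/-- The derivative along a field at any point of the chart at `x`, read in that chart. -/
theorem dirDeriv_chart_symm [IsManifold (𝓡 n) ∞ M] (X : VField n M) {h : M → F}
    {y : EuclideanSpace ℝ (Fin n)} (hy : y ∈ (extChartAt (𝓡 n) x).target)
    (hh : MDifferentiableAt (𝓡 n) 𝓘(ℝ, F) h ((extChartAt (𝓡 n) x).symm y)) :
    dirDeriv X h ((extChartAt (𝓡 n) x).symm y)
      = fderiv ℝ (h ∘ (extChartAt (𝓡 n) x).symm) y (chartField X x y) := by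
  have : IsManifold (𝓡 n) 1 M := .of_le (n := ∞) (by simp)
  have hinv := isInvertible_mfderivWithin_extChartAt_symm (I := 𝓡 n) hy
  have hs : MDifferentiableAt 𝓘(ℝ, EuclideanSpace ℝ (Fin n)) (𝓡 n)
      (extChartAt (𝓡 n) x).symm y := by
    have := mdifferentiableWithinAt_extChartAt_symm (I := 𝓡 n) hy
    rwa [ModelWithCorners.range_eq_univ, mdifferentiableWithinAt_univ] at this
  have hc := mfderiv_comp y hh hs
  rw [mfderiv_eq_fderiv] at hc
  rw [hc]
  simp only [chartField, VectorField.mpullbackWithin, dirDeriv]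
  rw [ModelWithCorners.range_eq_univ, mfderivWithin_univ] at hinv ⊢
  obtain ⟨e, he⟩ := hinv
  rw [← he]
  have h4 : (e : _ →L[ℝ] _).inverse (X ((extChartAt (𝓡 n) x).symm y))
      = e.symm (X ((extChartAt (𝓡 n) x).symm y)) := by
    rw [ContinuousLinearMap.inverse_equiv]
    rfl
  exact congrArg (mfderiv (𝓡 n) 𝓘(ℝ, F) h ((extChartAt (𝓡 n) x).symm y))
    ((e.apply_symm_apply _).symm.trans (congrArg e h4.symm))

theorem mfderiv_eq_fderiv_chart {h : M → F} (hh : MDifferentiableAt (𝓡 n) 𝓘(ℝ, F) h x) :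
    mfderiv (𝓡 n) 𝓘(ℝ, F) h x
      = fderiv ℝ (h ∘ (extChartAt (𝓡 n) x).symm) (extChartAt (𝓡 n) x x) := by
  rw [hh.mfderiv, ModelWithCorners.range_eq_univ, fderivWithin_univ]
  rfl

/-- The derivative of the chart at `x` is the identity of `T_x M = ℝⁿ` at `x` itself, so that no
coordinate change appears. -/
theorem mlieBracket_eq_chart [IsManifold (𝓡 n) ∞ M] (X Y : VField n M) :
    VectorField.mlieBracket (𝓡 n) X Y x
      = VectorField.lieBracket ℝ (chartField X x) (chartField Y x) (extChartAt (𝓡 n) x x) := by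
  have : IsManifold (𝓡 n) 1 M := .of_le (n := ∞) (by simp)
  have hset : (extChartAt (𝓡 n) x).symm ⁻¹' Set.univ ∩ Set.range (𝓡 n) = Set.univ := by
    rw [ModelWithCorners.range_eq_univ, Set.preimage_univ, Set.univ_inter]
  have h1 : VectorField.mlieBracket (𝓡 n) X Y x
      = (mfderiv (𝓡 n) 𝓘(ℝ, EuclideanSpace ℝ (Fin n)) (extChartAt (𝓡 n) x) x).inverse
        (VectorField.lieBracketWithin ℝ (chartField X x) (chartField Y x)
          ((extChartAt (𝓡 n) x).symm ⁻¹' Set.univ ∩ Set.range (𝓡 n))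
          (extChartAt (𝓡 n) x x)) := by
    rw [← VectorField.mlieBracketWithin_univ]
    exact VectorField.mlieBracketWithin_apply
  have h2 : VectorField.lieBracketWithin ℝ (chartField X x) (chartField Y x)
      ((extChartAt (𝓡 n) x).symm ⁻¹' Set.univ ∩ Set.range (𝓡 n))
      = VectorField.lieBracket ℝ (chartField X x) (chartField Y x) := by
    rw [hset, VectorField.lieBracketWithin_univ]
  have h3 : (mfderiv (𝓡 n) 𝓘(ℝ, EuclideanSpace ℝ (Fin n)) (extChartAt (𝓡 n) x) x).inverse
      = ContinuousLinearMap.id ℝ (EuclideanSpace ℝ (Fin n)) := by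
    rw [mfderiv_extChartAt_self]
    exact ContinuousLinearMap.inverse_id
  exact h1.trans ((congrFun (congrArg DFunLike.coe h3) _).trans (congrFun h2 _))

theorem SmoothFieldAt.differentiableAt_chartField [IsManifold (𝓡 n) ∞ M] {X : VField n M}
    (hX : SmoothFieldAt X x) : DifferentiableAt ℝ (chartField X x) (extChartAt (𝓡 n) x x) := by
  have : IsManifold (𝓡 n) 2 M := .of_le (n := ∞) ENat.LEInfty.out
  have hset : (extChartAt (𝓡 n) x).symm ⁻¹' Set.univ ∩ Set.range (𝓡 n) = Set.univ := by
    rw [ModelWithCorners.range_eq_univ, Set.preimage_univ, Set.univ_inter]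
  have h1 : DifferentiableWithinAt ℝ (chartField X x)
      ((extChartAt (𝓡 n) x).symm ⁻¹' Set.univ ∩ Set.range (𝓡 n)) (extChartAt (𝓡 n) x x) :=
    (ContMDiffAt.mdifferentiableAt hX (by simp)).mdifferentiableWithinAt
      (s := Set.univ) |>.differentiableWithinAt_mpullbackWithin_vectorField
  rwa [hset, differentiableWithinAt_univ] at h1

/-- The commutator of the derivatives along two vector fields is the derivative along their
Lie bracket. -/
theorem dirDeriv_mlieBracket [IsManifold (𝓡 n) ∞ M] {X Y : VField n M} {h : M → F}
    (hX : SmoothFieldAt X x) (hY : SmoothFieldAt Y x) (hh : SmoothAt n h x) :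
    dirDeriv (VectorField.mlieBracket (𝓡 n) X Y) h x
      = dirDeriv X (dirDeriv Y h) x - dirDeriv Y (dirDeriv X h) x := by
  have hM : IsManifold (𝓡 n) 1 M := .of_le (n := ∞) (by simp)
  set φ := extChartAt (𝓡 n) x
  have hx : φ.symm (φ x) = x := extChartAt_to_inv x
  -- The inner derivative is differentiated once more, so it has to be read in the chart near `φ x`.
  have hev : ∀ᶠ y in nhds (φ x), y ∈ φ.target ∧
      MDifferentiableAt (𝓡 n) 𝓘(ℝ, F) h (φ.symm y) := by
    have h1 : ∀ᶠ z in nhds x, MDifferentiableAt (𝓡 n) 𝓘(ℝ, F) h z := by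
      have h2 : ContMDiffAt (𝓡 n) 𝓘(ℝ, F) 1 h x := hh.of_le (by simp)
      filter_upwards [(contMDiffAt_iff_contMDiffAt_nhds (by simp)).1 h2] with z hz
      exact ContMDiffAt.mdifferentiableAt hz one_ne_zero
    refine Filter.Eventually.and (extChartAt_target_mem_nhds x) ?_
    have hc : ContinuousAt φ.symm (φ x) := continuousAt_extChartAt_symm x
    rw [ContinuousAt, hx] at hc
    exact hc.eventually h1
  have key : ∀ Z : VField n M, SmoothFieldAt Z x → ∀ Z' : VField n M, SmoothFieldAt Z' x →
      dirDeriv Z (dirDeriv Z' h) x = fderiv ℝ (fun y =>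
        fderiv ℝ (h ∘ φ.symm) y (chartField Z' x y)) (φ x) (chartField Z x (φ x)) := by
    intro Z hZ Z' hZ'
    have h1 := dirDeriv_chart_symm (x := x) Z (mem_extChartAt_target x)
      (h := dirDeriv Z' h) (by rw [extChartAt_to_inv]; exact (hZ'.dirDeriv hh).mdiff)
    rw [extChartAt_to_inv] at h1
    rw [h1]
    congr 1
    apply Filter.EventuallyEq.fderiv_eq
    filter_upwards [hev] with y hy
    exact dirDeriv_chart_symm Z' hy.1 hy.2
  have hC : ContDiffAt ℝ ∞ (h ∘ φ.symm) (φ x) := by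
    have := (contMDiffAt_iff.1 hh).2
    rw [ModelWithCorners.range_eq_univ, contDiffWithinAt_univ] at this
    simpa using! this
  rw [key X hX Y hY, key Y hY X hX, ← VectorField.fderiv_apply_lieBracket hC
    (by simpa using! ENat.LEInfty.out)
    hY.differentiableAt_chartField hX.differentiableAt_chartField]
  unfold dirDeriv
  rw [mlieBracket_eq_chart, mfderiv_eq_fderiv_chart hh.mdiff]
  rfl

end Calculus

/-! ### The metric; smoothness of a field tested against smooth fields -/

section Metric

variable {n m : ℕ} {M : Type*} [TopologicalSpace M] [ChartedSpace (EuclideanSpace ℝ (Fin n)) M]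
  [IsManifold (𝓡 n) ∞ M] {g : RiemMetric n M} {ι : M → EuclideanSpace ℝ (Fin m)} {f : M → ℝ}
  {x : M}

theorem RiemMetric.inner_gradient (g : RiemMetric n M) (f : M → ℝ) (x : M)
    (w : TangentSpace (𝓡 n) x) :
    g.inner x (g.gradient f x) w = mfderiv (𝓡 n) 𝓘(ℝ, ℝ) f x w :=
  g.inner_sharp x _ w

theorem RiemMetric.pair_gradient (g : RiemMetric n M) (f : M → ℝ) (X : VField n M) :
    g.pair (g.gradient f) X = dirDeriv X f :=
  funext fun x => g.inner_gradient f x (X x)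

theorem RiemMetric.pair_comm (g : RiemMetric n M) (X Y : VField n M) : g.pair X Y = g.pair Y X :=
  funext fun x => g.symm x (X x) (Y x)

theorem RiemMetric.ext_inner (g : RiemMetric n M) {v w : TangentSpace (𝓡 n) x}
    (h : ∀ u, g.inner x v u = g.inner x w u) : v = w := by
  by_contra hne
  have h1 := g.pos x (v - w) (sub_ne_zero.2 hne)
  have h2 : g.inner x (v - w) (v - w) = 0 := by
    rw [map_sub (g.inner x) v w]
    exact sub_eq_zero.2 (h _)
  exact h1.ne' h2

/-- A vector field whose scalar products with smooth vector fields are smooth is smooth: its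
coefficients in a local frame are obtained by inverting the Gram matrix of the frame. -/
theorem smoothFieldAt_of_pair
    (hg : ∀ X Y : VField n M, SmoothFieldAt X x → SmoothFieldAt Y x → SmoothAt n (g.pair X Y) x)
    {V : VField n M} (hV : ∀ W : VField n M, SmoothFieldAt W x → SmoothAt n (g.pair V W) x) :
    SmoothFieldAt V x := by
  set t := trivializationAt (EuclideanSpace ℝ (Fin n)) (TangentSpace (𝓡 n) : M → Type _) x
  set b := (EuclideanSpace.basisFun (Fin n) ℝ).toBasis
  have hx : x ∈ t.baseSet := FiberBundle.mem_baseSet_trivializationAt' x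
  have : ContMDiffVectorBundle 1 (EuclideanSpace ℝ (Fin n))
    (TangentSpace (𝓡 n) : M → Type _) (𝓡 n) := .of_le (n := ∞) (by simp)
  let E : Fin n → VField n M := t.localFrame b
  have hE : ∀ i, SmoothFieldAt (E i) x := fun i => contMDiffAt_localFrame_of_mem ∞ t b i hx
  have hEb : ∀ y (hy : y ∈ t.baseSet) i, E i y = t.basisAt b hy i := fun y hy i =>
    t.localFrame_apply_of_mem_baseSet b hy
  let c : M → Fin n → ℝ := fun y i => t.localFrameCoeff (𝓡 n) b i y (V y)
  have hc : ∀ y (hy : y ∈ t.baseSet), V y = ∑ i, c y i • E i y := by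
    intro y hy
    simp only [c, hEb y hy, Bundle.Trivialization.localFrameCoeff_apply_of_mem_baseSet t b hy V]
    exact ((t.basisAt b hy).sum_repr (V y)).symm
  -- The Gram matrix of the frame, as an endomorphism of `ℝⁿ` depending on the point.
  let G : M → (Fin n → ℝ) →L[ℝ] (Fin n → ℝ) := fun y =>
    ∑ i, ∑ j, g.pair (E i) (E j) y •
      (ContinuousLinearMap.proj (R := ℝ) (φ := fun _ : Fin n => ℝ) i).smulRight (Pi.single j (1 : ℝ))
  have hGapp : ∀ y a j, G y a j = g.inner y (∑ i, a i • E i y) (E j y) := by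
    intro y a j
    simp [G, RiemMetric.pair, Finset.sum_apply, Pi.single_apply, mul_comm]
  have hGs : SmoothAt n G x :=
    contMDiffAt_finsetSum fun i _ => contMDiffAt_finsetSum fun j _ =>
      (hg _ _ (hE i) (hE j)).smul contMDiffAt_const
  have hinj : ∀ y ∈ t.baseSet, Function.Injective (G y) := by
    intro y hy
    refine (injective_iff_map_eq_zero _).2 fun a ha => ?_
    have h1 : g.inner y (∑ i, a i • E i y) (∑ i, a i • E i y) = 0 := by
      conv_lhs => rw [map_sum]
      refine Finset.sum_eq_zero fun j _ => ?_
      rw [map_smul, ← hGapp, ha]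
      simp
    have h2 : ∑ i, a i • E i y = 0 := by
      by_contra h
      exact (g.pos y _ h).ne' h1
    simp only [hEb y hy] at h2
    exact funext (Fintype.linearIndependent_iff.1 (t.basisAt b hy).linearIndependent a h2)
  have hGe : ∀ y ∈ t.baseSet, ∃ e : (Fin n → ℝ) ≃L[ℝ] (Fin n → ℝ), (e : _ →L[ℝ] _) = G y := by
    intro y hy
    refine ⟨(LinearEquiv.ofInjectiveEndo (G y : (Fin n → ℝ) →ₗ[ℝ] (Fin n → ℝ))
      (hinj y hy)).toContinuousLinearEquiv, ?_⟩
    ext a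
    rfl
  have hcs : SmoothAt n c x := by
    obtain ⟨e, he⟩ := hGe x hx
    have h1 : SmoothAt n (fun y => (G y).inverse) x := by
      have : ContDiffAt ℝ ∞ ContinuousLinearMap.inverse (G x) := by
        rw [← he]; exact contDiffAt_map_inverse e
      exact this.contMDiffAt.comp x hGs
    have h2 : SmoothAt n (fun y j => g.pair V (E j) y) x :=
      contMDiffAt_pi_space.2 fun j => hV _ (hE j)
    refine (h1.clm_apply h2).congr_of_eventuallyEq ?_
    filter_upwards [t.open_baseSet.mem_nhds hx] with y hy
    obtain ⟨e, he⟩ := hGe y hy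
    have h3 : (fun j => g.pair V (E j) y) = G y (c y) := by
      ext j
      rw [hGapp, ← hc y hy]
      rfl
    rw [h3, ← he, ContinuousLinearMap.inverse_equiv]
    simp
  refine (contMDiffAt_iff_localFrameCoeff b hx).2 fun i => ?_
  exact contMDiffAt_pi_space.1 hcs i

end Metric

/-! ### The rescaled differential and the Levi-Civita connection -/

section Immersion

variable {n m : ℕ} {M : Type*} [TopologicalSpace M] [ChartedSpace (EuclideanSpace ℝ (Fin n)) M]
  {ι : M → EuclideanSpace ℝ (Fin m)} {f : M → ℝ} {x : M}

/-- The rescaled differential `e^{-f} dι` of `ι` at `x`, which is isometric on `(T_x M, g_x)`. -/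
def scaledDiff (ι : M → EuclideanSpace ℝ (Fin m)) (f : M → ℝ) (x : M) :
    TangentSpace (𝓡 n) x →L[ℝ] EuclideanSpace ℝ (Fin m) :=
  Real.exp (-f x) • differential ι x

/-- The image of a vector field under the rescaled differential `e^{-f} dι`. -/
def push (ι : M → EuclideanSpace ℝ (Fin m)) (f : M → ℝ) (X : VField n M) :
    M → EuclideanSpace ℝ (Fin m) :=
  fun x => scaledDiff ι f x (X x)

theorem push_eq (ι : M → EuclideanSpace ℝ (Fin m)) (f : M → ℝ) (X : VField n M) :
    push ι f X = fun x => Real.exp (-f x) • dirDeriv X ι x := rfl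

/-- The differential of a real function at `x`, with values in `ℝ` instead of the tangent space
of `ℝ`. -/
def formAt (f : M → ℝ) (x : M) : TangentSpace (𝓡 n) x →L[ℝ] ℝ :=
  mfderiv (𝓡 n) 𝓘(ℝ, ℝ) f x

theorem inner_normal_scaledDiff {u : EuclideanSpace ℝ (Fin m)}
    (hu : u ∈ normalSpace (n := n) ι x) (v : TangentSpace (𝓡 n) x) :
    ⟪u, scaledDiff ι f x v⟫_ℝ = 0 := by
  have h := (Submodule.mem_orthogonal' _ _).1 hu (differential ι x v) ⟨v, rfl⟩
  change ⟪u, Real.exp (-f x) • differential ι x v⟫_ℝ = 0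
  rw [real_inner_smul_right, h, mul_zero]

theorem normalProj_mem (u : EuclideanSpace ℝ (Fin m)) :
    (normalSpace (n := n) ι x).starProjection u ∈ normalSpace (n := n) ι x :=
  Submodule.starProjection_apply_mem _ u

theorem normalProj_scaledDiff (v : TangentSpace (𝓡 n) x) :
    (normalSpace (n := n) ι x).starProjection (scaledDiff ι f x v) = 0 := by
  refine (Submodule.starProjection_apply_eq_zero_iff _).2 ?_
  refine (Submodule.mem_orthogonal _ _).2 fun u hu => inner_normal_scaledDiff hu v

theorem normalProj_push (X : VField n M) :
    (normalSpace (n := n) ι x).starProjection (push ι f X x) = 0 := normalProj_scaledDiff (X x)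

theorem normalProj_of_mem {u : EuclideanSpace ℝ (Fin m)} (hu : u ∈ normalSpace (n := n) ι x) :
    (normalSpace (n := n) ι x).starProjection u = u :=
  Submodule.starProjection_eq_self_iff.2 hu

theorem inner_normalProj {u w : EuclideanSpace ℝ (Fin m)} (hw : w ∈ normalSpace (n := n) ι x) :
    ⟪(normalSpace (n := n) ι x).starProjection u, w⟫_ℝ = ⟪u, w⟫_ℝ := by
  rw [Submodule.inner_starProjection_left_eq_right, normalProj_of_mem hw]

theorem tensorPi_mem (X Y : VField n M) : tensorPi ι f X Y x ∈ normalSpace (n := n) ι x :=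
  Submodule.smul_mem _ _ (normalProj_mem _)

theorem range_differential_le :
    (LinearMap.range (differential (n := n) ι x).toLinearMap)
      ≤ LinearMap.range (scaledDiff (n := n) ι f x).toLinearMap := by
  rintro _ ⟨v, rfl⟩
  refine ⟨Real.exp (f x) • v, ?_⟩
  change Real.exp (-f x) • differential ι x (Real.exp (f x) • v) = differential ι x v
  rw [map_smul, smul_smul, ← Real.exp_add]
  simp

/-- The normal connection is compatible with the scalar product of `ℝᵐ`. -/
theorem dirDeriv_inner_normal {X : VField n M} {σ μ : M → EuclideanSpace ℝ (Fin m)}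
    (hσ : SmoothAt n σ x) (hμ : SmoothAt n μ x)
    (hσN : σ x ∈ normalSpace (n := n) ι x) (hμN : μ x ∈ normalSpace (n := n) ι x) :
    dirDeriv X (fun y => ⟪σ y, μ y⟫_ℝ) x
      = ⟪normalConnection ι X σ x, μ x⟫_ℝ + ⟪σ x, normalConnection ι X μ x⟫_ℝ := by
  rw [dirDeriv_inner X hσ hμ, normalConnection, normalConnection, inner_normalProj hμN,
    real_inner_comm _ (σ x), real_inner_comm _ (σ x), inner_normalProj hσN]

/-- `Π(·, Y)` at `x`, as a linear map of tangent vectors. -/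
def tensorPiAt (ι : M → EuclideanSpace ℝ (Fin m)) (f : M → ℝ) (Y : VField n M) (x : M) :
    TangentSpace (𝓡 n) x →L[ℝ] EuclideanSpace ℝ (Fin m) :=
  Real.exp (-f x) • (normalSpace (n := n) ι x).starProjection ∘L
    (mfderiv (𝓡 n) 𝓘(ℝ, EuclideanSpace ℝ (Fin m)) (fun y => differential ι y (Y y)) x :
      TangentSpace (𝓡 n) x →L[ℝ] EuclideanSpace ℝ (Fin m))

theorem tensorPi_eq (X Y : VField n M) : tensorPi ι f X Y x = tensorPiAt ι f Y x (X x) := rfl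

variable [IsManifold (𝓡 n) ∞ M] {g : RiemMetric n M}

namespace IsConformalImmersion

theorem inner_scaledDiff (hι : IsConformalImmersion g ι f) (v w : TangentSpace (𝓡 n) x) :
    ⟪scaledDiff ι f x v, scaledDiff ι f x w⟫_ℝ = g.inner x v w := by
  change ⟪Real.exp (-f x) • differential ι x v, Real.exp (-f x) • differential ι x w⟫_ℝ = _
  rw [real_inner_smul_left, real_inner_smul_right, hι.pullback, ← mul_assoc, ← mul_assoc,
    ← Real.exp_add, ← Real.exp_add]
  simp [two_mul]

theorem pair_eq (hι : IsConformalImmersion g ι f) (X Y : VField n M) :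
    g.pair X Y = fun x => ⟪push ι f X x, push ι f Y x⟫_ℝ :=
  funext fun _ => (hι.inner_scaledDiff _ _).symm

theorem smoothAt_push (hι : IsConformalImmersion g ι f) (hf : SmoothAt n f x) {X : VField n M}
    (hX : SmoothFieldAt X x) : SmoothAt n (push ι f X) x :=
  hf.exp_neg.smul (hX.dirDeriv (hι.smooth x))

theorem smoothAt_pair (hι : IsConformalImmersion g ι f) (hf : SmoothAt n f x) {X Y : VField n M}
    (hX : SmoothFieldAt X x) (hY : SmoothFieldAt Y x) : SmoothAt n (g.pair X Y) x := by
  rw [hι.pair_eq]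
  exact (hι.smoothAt_push hf hX).inner (hι.smoothAt_push hf hY)

theorem smoothFieldAt (hι : IsConformalImmersion g ι f) (hf : SmoothAt n f x) {V : VField n M}
    (hV : ∀ W : VField n M, SmoothFieldAt W x → SmoothAt n (g.pair V W) x) : SmoothFieldAt V x :=
  smoothFieldAt_of_pair (fun _ _ hX hY => hι.smoothAt_pair hf hX hY) hV

theorem dirDeriv_push (hι : IsConformalImmersion g ι f) (hf : SmoothAt n f x)
    (X : VField n M) {Y : VField n M} (hY : SmoothFieldAt Y x) :
    dirDeriv X (push ι f Y) x
      = Real.exp (-f x) • dirDeriv X (dirDeriv Y ι) x - dirDeriv X f x • push ι f Y x := by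
  rw [push_eq, dirDeriv_smul X hf.exp_neg (hY.dirDeriv (hι.smooth x)), dirDeriv_exp_neg X hf,
    smul_smul, neg_smul, mul_comm]
  abel

/-- The normal part of the derivative of `e^{-f} dι(Y)` is `Π`. -/
theorem normalProj_dirDeriv_push (hι : IsConformalImmersion g ι f) (hf : SmoothAt n f x)
    (X : VField n M) {Y : VField n M} (hY : SmoothFieldAt Y x) :
    (normalSpace (n := n) ι x).starProjection (dirDeriv X (push ι f Y) x)
      = tensorPi ι f X Y x := by
  rw [hι.dirDeriv_push hf X hY, map_sub, map_smul, map_smul, normalProj_push, smul_zero, sub_zero]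
  rfl

/-- The derivatives of `e^{-f} dι` along two vector fields commute up to the Lie bracket and
the derivatives of the conformal factor. -/
theorem dirDeriv_push_sub (hι : IsConformalImmersion g ι f) (hf : SmoothAt n f x)
    {X Y : VField n M} (hX : SmoothFieldAt X x) (hY : SmoothFieldAt Y x) :
    dirDeriv X (push ι f Y) x - dirDeriv Y (push ι f X) x
      = push ι f (VectorField.mlieBracket (𝓡 n) X Y) x - dirDeriv X f x • push ι f Y x
        + dirDeriv Y f x • push ι f X x := by
  have h := dirDeriv_mlieBracket hX hY (hι.smooth x)
  rw [hι.dirDeriv_push hf X hY, hι.dirDeriv_push hf Y hX,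
    congrFun (push_eq ι f (VectorField.mlieBracket (𝓡 n) X Y)) x]
  simp only [h, smul_sub]
  abel

/-- `Π` is symmetric, as the Lie bracket and the terms in `f` are tangential. -/
theorem tensorPi_comm (hι : IsConformalImmersion g ι f) (hf : SmoothAt n f x)
    {X Y : VField n M} (hX : SmoothFieldAt X x) (hY : SmoothFieldAt Y x) :
    tensorPi ι f X Y x = tensorPi ι f Y X x := by
  rw [← sub_eq_zero, ← hι.normalProj_dirDeriv_push hf X hY, ← hι.normalProj_dirDeriv_push hf Y hX,
    ← map_sub, hι.dirDeriv_push_sub hf hX hY, map_add, map_sub, map_smul, map_smul,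
    normalProj_push, normalProj_push, normalProj_push]
  simp

theorem dirDeriv_pair (hι : IsConformalImmersion g ι f) (hf : SmoothAt n f x) (X : VField n M)
    {Y Z : VField n M} (hY : SmoothFieldAt Y x) (hZ : SmoothFieldAt Z x) :
    dirDeriv X (g.pair Y Z) x = ⟪dirDeriv X (push ι f Y) x, push ι f Z x⟫_ℝ
      + ⟪push ι f Y x, dirDeriv X (push ι f Z) x⟫_ℝ := by
  rw [hι.pair_eq, dirDeriv_inner X (hι.smoothAt_push hf hY) (hι.smoothAt_push hf hZ)]

/-- The Koszul expression, computed in the ambient space. -/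
theorem koszul_eq (hι : IsConformalImmersion g ι f) (hf : SmoothAt n f x)
    {X Y W : VField n M} (hX : SmoothFieldAt X x) (hY : SmoothFieldAt Y x)
    (hW : SmoothFieldAt W x) :
    g.koszul X Y W x = ⟪dirDeriv X (push ι f Y) x, push ι f W x⟫_ℝ
      - dirDeriv Y f x * g.pair X W x + g.pair X Y x * dirDeriv W f x := by
  have key : ∀ A B C : VField n M, SmoothFieldAt A x → SmoothFieldAt B x →
      g.pair (VectorField.mlieBracket (𝓡 n) A B) C x
        = ⟪dirDeriv A (push ι f B) x, push ι f C x⟫_ℝ - ⟪dirDeriv B (push ι f A) x, push ι f C x⟫_ℝ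
          + dirDeriv A f x * g.pair B C x - dirDeriv B f x * g.pair A C x := by
    intro A B C hA hB
    have h := congrArg (fun u => ⟪u, push ι f C x⟫_ℝ) (hι.dirDeriv_push_sub hf hA hB)
    simp only [inner_sub_left, inner_add_left, real_inner_smul_left] at h
    simp only [hι.pair_eq]
    linarith
  simp only [RiemMetric.koszul, Pi.smul_apply, Pi.add_apply, Pi.sub_apply, smul_eq_mul,
    hι.dirDeriv_pair hf X hY hW, hι.dirDeriv_pair hf Y hX hW, hι.dirDeriv_pair hf W hX hY,
    key X Y W hX hY, key X W Y hX hW, key Y W X hY hW]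
  rw [real_inner_comm (dirDeriv X (push ι f W) x), real_inner_comm (dirDeriv Y (push ι f W) x),
    real_inner_comm (dirDeriv W (push ι f Y) x), g.pair_comm Y X, g.pair_comm W X,
    g.pair_comm W Y]
  ring

/-- The Levi-Civita connection of `g`, computed in the ambient space. -/
theorem inner_leviCivita (hι : IsConformalImmersion g ι f) (hf : SmoothAt n f x)
    {X Y : VField n M} (hX : SmoothFieldAt X x) (hY : SmoothFieldAt Y x)
    (w : TangentSpace (𝓡 n) x) :
    g.inner x (g.leviCivita X Y x) w = ⟪dirDeriv X (push ι f Y) x, scaledDiff ι f x w⟫_ℝ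
      - dirDeriv Y f x * g.inner x (X x) w
      + g.pair X Y x * formAt f x w := by
  -- The Koszul expression depends linearly on the value of the test field, so a basis suffices.
  let L : TangentSpace (𝓡 n) x →ₗ[ℝ] ℝ :=
    (innerₗ _ (dirDeriv X (push ι f Y) x)) ∘ₗ (scaledDiff ι f x).toLinearMap
      - dirDeriv Y f x • (g.inner x (X x)).toLinearMap
      + g.pair X Y x • (formAt f x).toLinearMap
  have hL : ((stdBasis x).constr ℝ fun i => g.koszul X Y
      (FiberBundle.extend (EuclideanSpace ℝ (Fin n)) (stdBasis x i)) x) = L := by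
    refine (stdBasis x).ext fun i => ?_
    rw [Module.Basis.constr_basis, hι.koszul_eq hf hX hY (FiberBundle.contMDiffAt_extend _ _ _)]
    simp only [push, RiemMetric.pair, dirDeriv, FiberBundle.extend_apply_self]
    rfl
  change g.inner x (g.sharp x _) w = L w
  rw [RiemMetric.inner_sharp, hL]

theorem pair_leviCivita (hι : IsConformalImmersion g ι f) (hf : SmoothAt n f x)
    {X Y : VField n M} (hX : SmoothFieldAt X x) (hY : SmoothFieldAt Y x) (W : VField n M) :
    g.pair (g.leviCivita X Y) W x = ⟪dirDeriv X (push ι f Y) x, push ι f W x⟫_ℝ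
      - dirDeriv Y f x * g.pair X W x + g.pair X Y x * dirDeriv W f x :=
  hι.inner_leviCivita hf hX hY (W x)

end IsConformalImmersion

end Immersion

/-! ### Tangential and normal parts; consequences for the connection and the Hessian -/

section Decomposition

variable {n m : ℕ} {M : Type*} [TopologicalSpace M] [ChartedSpace (EuclideanSpace ℝ (Fin n)) M]
  {ι : M → EuclideanSpace ℝ (Fin m)} {f : M → ℝ} {x : M} [IsManifold (𝓡 n) ∞ M]
  {g : RiemMetric n M}

/-- The vector field whose image under `e^{-f} dι` is the tangential part of `u`. -/
def tangentPart (g : RiemMetric n M) (ι : M → EuclideanSpace ℝ (Fin m)) (f : M → ℝ)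
    (u : M → EuclideanSpace ℝ (Fin m)) : VField n M :=
  fun x => g.sharp x ((innerₗ _ (u x)) ∘ₗ (scaledDiff ι f x).toLinearMap)

theorem inner_tangentPart (u : M → EuclideanSpace ℝ (Fin m)) (w : TangentSpace (𝓡 n) x) :
    g.inner x (tangentPart g ι f u x) w = ⟪u x, scaledDiff ι f x w⟫_ℝ :=
  g.inner_sharp x _ w

theorem pair_tangentPart (u : M → EuclideanSpace ℝ (Fin m)) (W : VField n M) :
    g.pair (tangentPart g ι f u) W = fun x => ⟪u x, push ι f W x⟫_ℝ :=
  funext fun x => inner_tangentPart u (W x)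

namespace IsConformalImmersion

/-- The images of `e^{-f} dι` and the normal spaces span `ℝᵐ`. -/
theorem tangent_add_normal (hι : IsConformalImmersion g ι f) (u : M → EuclideanSpace ℝ (Fin m)) :
    u x = push ι f (tangentPart g ι f u) x
      + (normalSpace (n := n) ι x).starProjection (u x) := by
  -- `u x` minus its normal part lies in the double orthogonal complement of the image of `dι`.
  have h1 : u x - (normalSpace (n := n) ι x).starProjection (u x)
      ∈ (normalSpace (n := n) ι x)ᗮ := Submodule.sub_starProjection_mem_orthogonal _
  rw [normalSpace, Submodule.orthogonal_orthogonal] at h1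
  obtain ⟨v, hv⟩ := range_differential_le (f := f) h1
  have hv' : scaledDiff ι f x v = u x - (normalSpace (n := n) ι x).starProjection (u x) := hv
  have h2 : tangentPart g ι f u x = v := by
    refine g.ext_inner fun w => ?_
    rw [inner_tangentPart, ← hι.inner_scaledDiff, hv', inner_sub_left,
      inner_normal_scaledDiff (normalProj_mem _), sub_zero]
  change u x = scaledDiff ι f x (tangentPart g ι f u x) + _
  rw [h2, hv']
  abel

theorem smoothFieldAt_tangentPart (hι : IsConformalImmersion g ι f) (hf : SmoothAt n f x)
    {u : M → EuclideanSpace ℝ (Fin m)} (hu : SmoothAt n u x) :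
    SmoothFieldAt (tangentPart g ι f u) x :=
  hι.smoothFieldAt hf fun W hW => by
    rw [pair_tangentPart]
    exact hu.inner (hι.smoothAt_push hf hW)

theorem smoothAt_normalProj (hι : IsConformalImmersion g ι f) (hf : SmoothAt n f x)
    {u : M → EuclideanSpace ℝ (Fin m)} (hu : SmoothAt n u x) :
    SmoothAt n (fun y => (normalSpace (n := n) ι y).starProjection (u y)) x := by
  have h : (fun y => (normalSpace (n := n) ι y).starProjection (u y))
      = u - push ι f (tangentPart g ι f u) := by
    funext y
    exact eq_sub_of_add_eq' (hι.tangent_add_normal u).symm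
  rw [h]
  exact ContMDiffAt.sub hu (hι.smoothAt_push hf (hι.smoothFieldAt_tangentPart hf hu))

theorem smoothAt_normalConnection (hι : IsConformalImmersion g ι f) (hf : SmoothAt n f x)
    {X : VField n M} (hX : SmoothFieldAt X x) {μ : M → EuclideanSpace ℝ (Fin m)}
    (hμ : SmoothAt n μ x) : SmoothAt n (normalConnection ι X μ) x :=
  hι.smoothAt_normalProj hf (hX.dirDeriv hμ)

theorem smoothAt_tensorPi (hι : IsConformalImmersion g ι f) (hf : SmoothAt n f x)
    {X Y : VField n M} (hX : SmoothFieldAt X x) (hY : SmoothFieldAt Y x) :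
    SmoothAt n (tensorPi ι f X Y) x :=
  hf.exp_neg.smul (hι.smoothAt_normalProj hf (hX.dirDeriv (hY.dirDeriv (hι.smooth x))))

theorem smoothFieldAt_gradient (hι : IsConformalImmersion g ι f) (hf : SmoothAt n f x) :
    SmoothFieldAt (g.gradient f) x :=
  hι.smoothFieldAt hf fun W hW => by
    rw [g.pair_gradient]
    exact hW.dirDeriv hf

/-- The Koszul formula in the ambient space also shows that `∇_X Y` is smooth. -/
theorem smoothField_leviCivita (hι : IsConformalImmersion g ι f) (hf : ∀ x, SmoothAt n f x)
    {X Y : VField n M} (hX : SmoothField X) (hY : SmoothField Y) :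
    SmoothField (g.leviCivita X Y) := fun x =>
  hι.smoothFieldAt (hf x) fun W hW => by
    have h : g.pair (g.leviCivita X Y) W = fun y =>
        ⟪dirDeriv X (push ι f Y) y, push ι f W y⟫_ℝ
          - dirDeriv Y f y * g.pair X W y + g.pair X Y y * dirDeriv W f y :=
      funext fun y => hι.pair_leviCivita (hf y) (hX y) (hY y) W
    rw [h]
    refine SmoothAt.add (SmoothAt.sub ?_ ?_) ?_
    · exact ((hX.at x).dirDeriv (hι.smoothAt_push (hf x) (hY x))).inner (hι.smoothAt_push (hf x) hW)
    · exact ((hY.at x).dirDeriv (hf x)).smul (hι.smoothAt_pair (hf x) (hX x) hW)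
    · exact (hι.smoothAt_pair (hf x) (hX x) (hY x)).smul (hW.dirDeriv (hf x))

/-- The derivative of `e^{-f} dι(Y)`: its tangential part is given by the Levi-Civita connection
of `g` and the conformal factor, its normal part by `Π`. -/
theorem dirDeriv_push_eq (hι : IsConformalImmersion g ι f) (hf : SmoothAt n f x)
    {X Y : VField n M} (hX : SmoothFieldAt X x) (hY : SmoothFieldAt Y x) :
    dirDeriv X (push ι f Y) x = push ι f (g.leviCivita X Y) x + dirDeriv Y f x • push ι f X x
      - g.pair X Y x • push ι f (g.gradient f) x + tensorPi ι f X Y x := by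
  have h1 := hι.tangent_add_normal (x := x) (dirDeriv X (push ι f Y))
  rw [hι.normalProj_dirDeriv_push hf X hY] at h1
  have h2 : tangentPart g ι f (dirDeriv X (push ι f Y)) x
      = g.leviCivita X Y x + dirDeriv Y f x • X x - g.pair X Y x • g.gradient f x := by
    refine g.ext_inner fun w => ?_
    have h3 : g.inner x (g.leviCivita X Y x + dirDeriv Y f x • X x
        - g.pair X Y x • g.gradient f x) w = g.inner x (g.leviCivita X Y x) w
          + dirDeriv Y f x * g.inner x (X x) w - g.pair X Y x * formAt f x w := by
      rw [map_sub, map_add, map_smul, map_smul]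
      change _ + _ * _ - _ * g.inner x (g.gradient f x) w = _
      rw [g.inner_gradient]
      rfl
    rw [h3, inner_tangentPart, hι.inner_leviCivita hf hX hY]
    ring
  rw [h1]
  simp only [push, h2, map_sub, map_add, map_smul]

/-- `∇ g = 0`. -/
theorem dirDeriv_pair_eq (hι : IsConformalImmersion g ι f) (hf : SmoothAt n f x)
    {X Y Z : VField n M} (hX : SmoothFieldAt X x) (hY : SmoothFieldAt Y x)
    (hZ : SmoothFieldAt Z x) :
    dirDeriv X (g.pair Y Z) x
      = g.pair (g.leviCivita X Y) Z x + g.pair Y (g.leviCivita X Z) x := by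
  rw [hι.dirDeriv_pair hf X hY hZ, g.pair_comm Y (g.leviCivita X Z),
    hι.pair_leviCivita hf hX hY, hι.pair_leviCivita hf hX hZ,
    real_inner_comm (dirDeriv X (push ι f Z) x)]
  ring

/-- `∇` is torsion-free. -/
theorem mlieBracket_eq (hι : IsConformalImmersion g ι f) (hf : SmoothAt n f x)
    {X Y : VField n M} (hX : SmoothFieldAt X x) (hY : SmoothFieldAt Y x) :
    VectorField.mlieBracket (𝓡 n) X Y x = g.leviCivita X Y x - g.leviCivita Y X x := by
  refine g.ext_inner fun w => ?_
  have h := congrArg (fun u => ⟪u, scaledDiff ι f x w⟫_ℝ) (hι.dirDeriv_push_sub hf hX hY)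
  simp only [inner_sub_left, inner_add_left, real_inner_smul_left, push,
    hι.inner_scaledDiff] at h
  rw [map_sub]
  change _ = g.inner x (g.leviCivita X Y x) w - g.inner x (g.leviCivita Y X x) w
  rw [hι.inner_leviCivita hf hX hY, hι.inner_leviCivita hf hY hX, g.pair_comm Y X]
  linarith

/-- The Hessian in terms of the gradient. -/
theorem hessian_eq (hι : IsConformalImmersion g ι f) (hf : SmoothAt n f x)
    {X Y : VField n M} (hX : SmoothFieldAt X x) (hY : SmoothFieldAt Y x) :
    g.hessian f X Y x = g.pair (g.leviCivita X (g.gradient f)) Y x := by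
  have h := hι.dirDeriv_pair_eq hf hX (hι.smoothFieldAt_gradient hf) hY
  rw [g.pair_gradient, g.pair_gradient] at h
  simp only [RiemMetric.hessian, Pi.sub_apply, h]
  ring

/-- The Hessian is symmetric, as `∇` is torsion-free. -/
theorem hessian_comm (hι : IsConformalImmersion g ι f) (hf : SmoothAt n f x)
    {X Y : VField n M} (hX : SmoothFieldAt X x) (hY : SmoothFieldAt Y x) :
    g.hessian f X Y x = g.hessian f Y X x := by
  have h1 := dirDeriv_mlieBracket hX hY hf
  have h2 : dirDeriv (VectorField.mlieBracket (𝓡 n) X Y) f x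
      = dirDeriv (g.leviCivita X Y) f x - dirDeriv (g.leviCivita Y X) f x := by
    change formAt f x _ = formAt f x _ - formAt f x _
    rw [hι.mlieBracket_eq hf hX hY, map_sub]
  simp only [RiemMetric.hessian, Pi.sub_apply]
  linarith

end IsConformalImmersion

end Decomposition

/-! ### Gauss, Codazzi, Ricci, and the covariant derivative of `B` -/

section Equations

variable {n m : ℕ} {M : Type*} [TopologicalSpace M] [ChartedSpace (EuclideanSpace ℝ (Fin n)) M]
  {ι : M → EuclideanSpace ℝ (Fin m)} {f : M → ℝ} {x : M} [IsManifold (𝓡 n) ∞ M]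
  {g : RiemMetric n M}

namespace IsConformalImmersion

/-- The tangential part of the derivative of a normal field is minus the shape operator. -/
theorem inner_dirDeriv_normal (hι : IsConformalImmersion g ι f) (hf : SmoothAt n f x)
    (X : VField n M) {W : VField n M} (hW : SmoothFieldAt W x) {σ : M → EuclideanSpace ℝ (Fin m)}
    (hσ : SmoothAt n σ x) (hσN : ∀ y, σ y ∈ normalSpace (n := n) ι y) :
    ⟪dirDeriv X σ x, push ι f W x⟫_ℝ = -⟪σ x, tensorPi ι f X W x⟫_ℝ := by
  have h0 : (fun y => ⟪σ y, push ι f W y⟫_ℝ) = fun _ => 0 :=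
    funext fun y => inner_normal_scaledDiff (hσN y) _
  have h1 := dirDeriv_inner X hσ (hι.smoothAt_push hf hW)
  rw [h0, dirDeriv_const] at h1
  rw [← hι.normalProj_dirDeriv_push hf X hW, real_inner_comm _ (σ x), inner_normalProj (hσN x),
    real_inner_comm (σ x)]
  linarith

/-- The second derivative of `e^{-f} dι(Z)`, decomposed by means of `dirDeriv_push_eq`. -/
theorem dirDeriv_dirDeriv_push (hι : IsConformalImmersion g ι f) (hf : ∀ x, SmoothAt n f x)
    (X : VField n M) {Y Z : VField n M} (hY : SmoothField Y) (hZ : SmoothField Z) (x : M) :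
    dirDeriv X (dirDeriv Y (push ι f Z)) x
      = dirDeriv X (push ι f (g.leviCivita Y Z)) x
        + (dirDeriv X (dirDeriv Z f) x • push ι f Y x + dirDeriv Z f x • dirDeriv X (push ι f Y) x)
        - (dirDeriv X (g.pair Y Z) x • push ι f (g.gradient f) x
          + g.pair Y Z x • dirDeriv X (push ι f (g.gradient f)) x)
        + dirDeriv X (tensorPi ι f Y Z) x := by
  have h : dirDeriv Y (push ι f Z) = fun y => push ι f (g.leviCivita Y Z) y
      + dirDeriv Z f y • push ι f Y y - g.pair Y Z y • push ι f (g.gradient f) y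
      + tensorPi ι f Y Z y :=
    funext fun y => hι.dirDeriv_push_eq (hf y) (hY y) (hZ y)
  have h1 : SmoothAt n (push ι f (g.leviCivita Y Z)) x :=
    hι.smoothAt_push (hf x) (hι.smoothField_leviCivita hf hY hZ x)
  have h2 : SmoothAt n (dirDeriv Z f) x := (hZ.at x).dirDeriv (hf x)
  have h3 : SmoothAt n (push ι f Y) x := hι.smoothAt_push (hf x) (hY x)
  have h4 : SmoothAt n (g.pair Y Z) x := hι.smoothAt_pair (hf x) (hY x) (hZ x)
  have h5 : SmoothAt n (push ι f (g.gradient f)) x :=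
    hι.smoothAt_push (hf x) (hι.smoothFieldAt_gradient (hf x))
  have h6 : SmoothAt n (tensorPi ι f Y Z) x := hι.smoothAt_tensorPi (hf x) (hY x) (hZ x)
  rw [h, dirDeriv_add X ((h1.add (h2.smul h3)).sub (h4.smul h5)) h6,
    dirDeriv_sub X (h1.add (h2.smul h3)) (h4.smul h5),
    dirDeriv_add X h1 (h2.smul h3), dirDeriv_smul X h2 h3, dirDeriv_smul X h4 h5]

theorem smoothField_mlieBracket (hι : IsConformalImmersion g ι f) (hf : ∀ x, SmoothAt n f x)
    {X Y : VField n M} (hX : SmoothField X) (hY : SmoothField Y) :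
    SmoothField (VectorField.mlieBracket (𝓡 n) X Y) := fun x => by
  refine hι.smoothFieldAt (hf x) fun W hW => ?_
  have h : g.pair (VectorField.mlieBracket (𝓡 n) X Y) W
      = g.pair (g.leviCivita X Y) W - g.pair (g.leviCivita Y X) W := by
    funext y
    simp only [RiemMetric.pair, hι.mlieBracket_eq (hf y) (hX y) (hY y), Pi.sub_apply]
    rw [map_sub]
    rfl
  rw [h]
  exact ContMDiffAt.sub
    (hι.smoothAt_pair (hf x) (hι.smoothField_leviCivita hf hX hY x) hW)
    (hι.smoothAt_pair (hf x) (hι.smoothField_leviCivita hf hY hX x) hW)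

theorem pair_mlieBracket (hι : IsConformalImmersion g ι f) (hf : SmoothAt n f x)
    {X Y : VField n M} (hX : SmoothFieldAt X x) (hY : SmoothFieldAt Y x) (W : VField n M) :
    g.pair (VectorField.mlieBracket (𝓡 n) X Y) W x
      = g.pair (g.leviCivita X Y) W x - g.pair (g.leviCivita Y X) W x := by
  simp only [RiemMetric.pair, hι.mlieBracket_eq hf hX hY]
  rw [map_sub]
  rfl

/-- The Gauss equation. -/
theorem gauss (hι : IsConformalImmersion g ι f) (hf : ∀ x, SmoothAt n f x)
    {X Y Z W : VField n M} (hX : SmoothField X) (hY : SmoothField Y) (hZ : SmoothField Z)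
    (hW : SmoothField W) (x : M) :
    g.pair (g.leviCivita X (g.leviCivita Y Z)) W x - g.pair (g.leviCivita Y (g.leviCivita X Z)) W x
        - g.pair (g.leviCivita (VectorField.mlieBracket (𝓡 n) X Y) Z) W x
        - ⟪tensorPi ι f Y Z x, tensorPi ι f X W x⟫_ℝ
        + ⟪tensorPi ι f X Z x, tensorPi ι f Y W x⟫_ℝ
      = -kulkarniNomizu g.pair (tensorB g f) X Y Z W x := by
  have hgr : SmoothField (g.gradient f) := fun y => hι.smoothFieldAt_gradient (hf y)
  have hbr := hι.smoothField_mlieBracket hf hX hY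
  -- The tangential part of `∂_A ∂_B (T Z)`; derivatives of products are expanded so that only
  -- quantities at the point `x` remain.
  have expand : ∀ A B : VField n M, SmoothField A → SmoothField B →
      ⟪dirDeriv A (dirDeriv B (push ι f Z)) x, push ι f W x⟫_ℝ
        = g.pair (g.leviCivita A (g.leviCivita B Z)) W x
          + dirDeriv (g.leviCivita B Z) f x * g.pair A W x
          - g.pair A (g.leviCivita B Z) x * dirDeriv W f x
          + (g.hessian f A Z x + dirDeriv (g.leviCivita A Z) f x) * g.pair B W x
          + dirDeriv Z f x * (g.pair (g.leviCivita A B) W x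
            + dirDeriv B f x * g.pair A W x - g.pair A B x * dirDeriv W f x)
          - (g.pair (g.leviCivita A B) Z x + g.pair B (g.leviCivita A Z) x) * dirDeriv W f x
          - g.pair B Z x * (g.hessian f A W x
            + g.pair (g.gradient f) (g.gradient f) x * g.pair A W x
            - dirDeriv A f x * dirDeriv W f x)
          - ⟪tensorPi ι f B Z x, tensorPi ι f A W x⟫_ℝ := by
    intro A B hA hB
    have k1 := hι.pair_leviCivita (hf x) (hA x) (hι.smoothField_leviCivita hf hB hZ x) W
    have k2 := hι.pair_leviCivita (hf x) (hA x) (hB x) W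
    have k3 := hι.pair_leviCivita (hf x) (hA x) (hgr x) W
    have k4 := hι.dirDeriv_pair_eq (hf x) (hA x) (hB x) (hZ x)
    have k5 := hι.hessian_eq (hf x) (hA x) (hW x)
    have k6 : g.hessian f A Z x = dirDeriv A (dirDeriv Z f) x - dirDeriv (g.leviCivita A Z) f x :=
      rfl
    have k7 := hι.inner_dirDeriv_normal (hf x) A (hW x)
      (hι.smoothAt_tensorPi (hf x) (hB x) (hZ x)) (fun y => tensorPi_mem (x := y) B Z)
    have k8 : ∀ V W : VField n M, ⟪push ι f V x, push ι f W x⟫_ℝ = g.pair V W x :=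
      fun V W => hι.inner_scaledDiff _ _
    have k9 : dirDeriv (g.gradient f) f x = g.pair (g.gradient f) (g.gradient f) x :=
      (congrFun (g.pair_gradient f (g.gradient f)) x).symm
    have k10 : g.pair A (g.gradient f) x = dirDeriv A f x := by
      rw [g.pair_comm, g.pair_gradient]
    have k11 : g.pair (g.gradient f) W x = dirDeriv W f x := congrFun (g.pair_gradient f W) x
    rw [k9, k10] at k3
    rw [hι.dirDeriv_dirDeriv_push hf A hB hZ x]
    simp only [inner_add_left, inner_sub_left, real_inner_smul_left, k7, k8, k11]
    rw [k4]
    linear_combination k1 * (-1) - dirDeriv Z f x * k2 + g.pair B Z x * (k3 + k5)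
      + g.pair B W x * k6 * (-1)
  have h0 := congrArg (fun u => ⟪u, push ι f W x⟫_ℝ)
    (dirDeriv_mlieBracket (hX x) (hY x) (hι.smoothAt_push (hf x) (hZ x)))
  simp only [inner_sub_left, expand X Y hX hY, expand Y X hY hX] at h0
  have h1 := hι.pair_leviCivita (hf x) (hbr x) (hZ x) W
  have h2 := hι.pair_mlieBracket (hf x) (hX x) (hY x)
  rw [h2, h2] at h1
  simp only [kulkarniNomizu, tensorB, Pi.add_apply, Pi.sub_apply, Pi.mul_apply, Pi.smul_apply,
    smul_eq_mul]
  rw [g.pair_comm Y X] at h0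
  rw [g.pair_comm X (g.leviCivita Y Z), g.pair_comm Y (g.leviCivita X Z)] at h0
  linear_combination -h1 - h0

/-- The Codazzi equation. -/
theorem codazzi (hι : IsConformalImmersion g ι f) (hf : ∀ x, SmoothAt n f x)
    {X Y Z : VField n M} (hX : SmoothField X) (hY : SmoothField Y) (hZ : SmoothField Z) (x : M) :
    nablaPi g ι f X Y Z x - nablaPi g ι f Y X Z x
      = g.pair Y Z x • tensorD g ι f X x - g.pair X Z x • tensorD g ι f Y x := by
  have hgr : SmoothField (g.gradient f) := fun y => hι.smoothFieldAt_gradient (hf y)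
  have expand : ∀ A B : VField n M, SmoothField A → SmoothField B →
      (normalSpace (n := n) ι x).starProjection (dirDeriv A (dirDeriv B (push ι f Z)) x)
        = tensorPi ι f (g.leviCivita B Z) A x + dirDeriv Z f x • tensorPi ι f A B x
          - g.pair B Z x • tensorD g ι f A x + normalConnection ι A (tensorPi ι f B Z) x := by
    intro A B hA hB
    have hBZ := hι.smoothField_leviCivita hf hB hZ
    rw [hι.dirDeriv_dirDeriv_push hf A hB hZ x]
    simp only [map_add, map_sub, map_smul, normalProj_push, smul_zero, zero_add,
      hι.normalProj_dirDeriv_push (hf x) A (hBZ x), hι.normalProj_dirDeriv_push (hf x) A (hB x),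
      hι.normalProj_dirDeriv_push (hf x) A (hgr x)]
    rw [hι.tensorPi_comm (hf x) (hA x) (hBZ x), hι.tensorPi_comm (hf x) (hA x) (hgr x)]
    rfl
  have h0 := congrArg (normalSpace (n := n) ι x).starProjection
    (dirDeriv_mlieBracket (hX x) (hY x) (hι.smoothAt_push (hf x) (hZ x)))
  rw [map_sub, expand X Y hX hY, expand Y X hY hX, hι.normalProj_dirDeriv_push (hf x) _ (hZ x),
    tensorPi_eq, hι.mlieBracket_eq (hf x) (hX x) (hY x), map_sub, ← tensorPi_eq, ← tensorPi_eq,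
    hι.tensorPi_comm (hf x) (hY x) (hX x)] at h0
  simp only [nablaPi, covDerivTensor, Pi.sub_apply]
  rw [hι.tensorPi_comm (hf x) (hY x) (hι.smoothField_leviCivita hf hX hZ x),
    hι.tensorPi_comm (hf x) (hX x) (hι.smoothField_leviCivita hf hY hZ x)]
  linear_combination (norm := module) (-1 : ℝ) • h0

/-- The Ricci equation; the shape operators are expressed through `tangentPart`. -/
theorem ricci (hι : IsConformalImmersion g ι f) (hf : ∀ x, SmoothAt n f x)
    {X Y : VField n M} (hX : SmoothField X) (hY : SmoothField Y)
    {μ ν : M → EuclideanSpace ℝ (Fin m)} (hμ : ∀ x, SmoothAt n μ x)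
    (hν : ν x ∈ normalSpace (n := n) ι x) :
    ⟪(curvature (normalConnection ι) X Y μ) x, ν x⟫_ℝ
      = ⟪tensorPi ι f (tangentPart g ι f (dirDeriv X μ)) Y x, ν x⟫_ℝ
        - ⟪tensorPi ι f (tangentPart g ι f (dirDeriv Y μ)) X x, ν x⟫_ℝ := by
  have expand : ∀ A B : VField n M, SmoothField A → SmoothField B →
      ⟪dirDeriv A (dirDeriv B μ) x, ν x⟫_ℝ
        = ⟪tensorPi ι f (tangentPart g ι f (dirDeriv B μ)) A x, ν x⟫_ℝ
          + ⟪normalConnection ι A (normalConnection ι B μ) x, ν x⟫_ℝ := by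
    intro A B hA hB
    have h : dirDeriv B μ = fun y => push ι f (tangentPart g ι f (dirDeriv B μ)) y
        + normalConnection ι B μ y := funext fun y => hι.tangent_add_normal (dirDeriv B μ)
    have h1 := hι.smoothFieldAt_tangentPart (hf x) ((hB.at x).dirDeriv (hμ x))
    have h2 := inner_normalProj (u := dirDeriv A (push ι f (tangentPart g ι f (dirDeriv B μ))) x) hν
    rw [hι.normalProj_dirDeriv_push (hf x) A h1, hι.tensorPi_comm (hf x) (hA x) h1] at h2
    have h3 := inner_normalProj (u := dirDeriv A (normalConnection ι B μ) x) hν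
    conv_lhs => rw [h]
    rw [dirDeriv_add A (hι.smoothAt_push (hf x) h1)
      (hι.smoothAt_normalConnection (hf x) (hB x) (hμ x)), inner_add_left, ← h2, ← h3]
    rfl
  have h0 := congrArg (fun u => ⟪u, ν x⟫_ℝ) (dirDeriv_mlieBracket (hX x) (hY x) (hμ x))
  simp only [inner_sub_left, expand X Y hX hY, expand Y X hY hX] at h0
  rw [← inner_normalProj hν] at h0
  simp only [curvature, Pi.sub_apply, inner_sub_left]
  change _ - _ - ⟪(normalSpace (n := n) ι x).starProjection _, _⟫_ℝ = _
  rw [h0]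
  ring

/-- The antisymmetric part of `∇B` is `g(R_{XY} ∇f, Z) + (g ⊛ B)(X, Y, ∇f, Z)`, which the Gauss
equation expresses through `Π`. -/
theorem nablaB_add_inner (hι : IsConformalImmersion g ι f) (hf : ∀ x, SmoothAt n f x)
    {X Y Z : VField n M} (hX : SmoothField X) (hY : SmoothField Y) (hZ : SmoothField Z) (x : M) :
    nablaB g f X Y Z x + ⟪tensorD g ι f X x, tensorPi ι f Y Z x⟫_ℝ
      = nablaB g f Y X Z x + ⟪tensorD g ι f Y x, tensorPi ι f X Z x⟫_ℝ := by
  have hgr : SmoothField (g.gradient f) := fun y => hι.smoothFieldAt_gradient (hf y)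
  have hbr := hι.smoothField_mlieBracket hf hX hY
  have kgr : ∀ V : VField n M, g.pair (g.gradient f) V x = dirDeriv V f x :=
    fun V => congrFun (g.pair_gradient f V) x
  have expand : ∀ A B : VField n M, SmoothField A → SmoothField B →
      nablaB g f A B Z x = g.pair (g.leviCivita A (g.leviCivita B (g.gradient f))) Z x
        - g.hessian f (g.leviCivita A B) Z x
        - g.hessian f A B x * dirDeriv Z f x - dirDeriv B f x * g.hessian f A Z x
        + g.hessian f A (g.gradient f) x * g.pair B Z x := by
    intro A B hA hB
    have hAZ := hι.smoothField_leviCivita hf hA hZ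
    have hBg := hι.smoothField_leviCivita hf hB hgr
    have s1 : SmoothAt n (g.pair (g.leviCivita B (g.gradient f)) Z) x :=
      hι.smoothAt_pair (hf x) (hBg x) (hZ x)
    have s2 : SmoothAt n (dirDeriv B f) x := (hB.at x).dirDeriv (hf x)
    have s3 : SmoothAt n (dirDeriv Z f) x := (hZ.at x).dirDeriv (hf x)
    have s4 : SmoothAt n (g.pair (g.gradient f) (g.gradient f)) x :=
      hι.smoothAt_pair (hf x) (hgr x) (hgr x)
    have s5 : SmoothAt n (g.pair B Z) x := hι.smoothAt_pair (hf x) (hB x) (hZ x)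
    have s6 : SmoothAt n (fun _ : M => (1 / 2 : ℝ)) x := contMDiffAt_const
    have hB' : tensorB g f B Z = fun y => g.pair (g.leviCivita B (g.gradient f)) Z y
        - dirDeriv B f y * dirDeriv Z f y
        + (1 / 2 : ℝ) * (g.pair (g.gradient f) (g.gradient f) y * g.pair B Z y) := by
      funext y
      simp only [tensorB, Pi.add_apply, Pi.sub_apply, Pi.mul_apply, Pi.smul_apply, smul_eq_mul,
        hι.hessian_eq (hf y) (hB y) (hZ y)]
    have hd : dirDeriv A (tensorB g f B Z) x
        = dirDeriv A (g.pair (g.leviCivita B (g.gradient f)) Z) x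
          - (dirDeriv A (dirDeriv B f) x * dirDeriv Z f x
            + dirDeriv B f x * dirDeriv A (dirDeriv Z f) x)
          + (1 / 2 : ℝ) * (dirDeriv A (g.pair (g.gradient f) (g.gradient f)) x * g.pair B Z x
            + g.pair (g.gradient f) (g.gradient f) x * dirDeriv A (g.pair B Z) x) := by
      rw [hB', dirDeriv_add A (s1.sub (s2.mul s3)) (s6.mul (s4.mul s5)),
        dirDeriv_sub A s1 (s2.mul s3), dirDeriv_mul A s2 s3, dirDeriv_mul A s6 (s4.mul s5),
        dirDeriv_mul A s4 s5, dirDeriv_const]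
      ring
    have t1 := hι.dirDeriv_pair_eq (hf x) (hA x) (hBg x) (hZ x)
    have t2 := hι.dirDeriv_pair_eq (hf x) (hA x) (hB x) (hZ x)
    have t3 := hι.dirDeriv_pair_eq (hf x) (hA x) (hgr x) (hgr x)
    have t4 := hι.hessian_eq (hf x) (hA x) (hgr x)
    have t5 := hι.hessian_eq (hf x) (hB x) (hAZ x)
    have t6 : ∀ V, dirDeriv A (dirDeriv V f) x
        = g.hessian f A V x + dirDeriv (g.leviCivita A V) f x :=
      fun V => (sub_add_cancel _ _).symm
    rw [g.pair_comm (g.gradient f) (g.leviCivita A _), ← t4] at t3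
    simp only [nablaB, covDerivTensor, Pi.sub_apply, hd, t1, t2, t3, t6]
    simp only [tensorB, Pi.add_apply, Pi.sub_apply, Pi.mul_apply, Pi.smul_apply, smul_eq_mul, t5]
    ring
  -- The curvature term comes from the Gauss equation for the field `∇f`.
  have hG := hι.gauss hf hX hY hgr hZ x
  have t1 := hι.hessian_eq (hf x) (hbr x) (hZ x)
  have t2 : g.hessian f (VectorField.mlieBracket (𝓡 n) X Y) Z x
      = g.hessian f (g.leviCivita X Y) Z x - g.hessian f (g.leviCivita Y X) Z x := by
    rw [hι.hessian_comm (hf x) (hbr x) (hZ x),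
      hι.hessian_comm (hf x) (hι.smoothField_leviCivita hf hX hY x) (hZ x),
      hι.hessian_comm (hf x) (hι.smoothField_leviCivita hf hY hX x) (hZ x),
      hι.hessian_eq (hf x) (hZ x) (hbr x),
      hι.hessian_eq (hf x) (hZ x) (hι.smoothField_leviCivita hf hX hY x),
      hι.hessian_eq (hf x) (hZ x) (hι.smoothField_leviCivita hf hY hX x),
      g.pair_comm, hι.pair_mlieBracket (hf x) (hX x) (hY x), g.pair_comm _ (g.leviCivita X Y),
      g.pair_comm _ (g.leviCivita Y X)]
  rw [expand X Y hX hY, expand Y X hY hX, hι.hessian_comm (hf x) (hY x) (hX x)]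
  simp only [kulkarniNomizu, tensorB, Pi.add_apply, Pi.sub_apply, Pi.mul_apply, Pi.smul_apply,
    smul_eq_mul, kgr, g.pair_comm _ (g.gradient f)] at hG
  rw [← t1, t2, hι.tensorPi_comm (hf x) (hY x) (hgr x),
    hι.tensorPi_comm (hf x) (hX x) (hgr x), real_inner_comm (tensorPi ι f X Z x)] at hG
  change _ + ⟪tensorPi ι f (g.gradient f) X x, _⟫_ℝ = _ + ⟪tensorPi ι f (g.gradient f) Y x, _⟫_ℝ
  rw [real_inner_comm (tensorPi ι f X Z x)]
  linear_combination hG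

end IsConformalImmersion

end Equations

/-! ### Contractions along orthonormal frames and the covariant derivative of `D_♭` -/

section Frame

variable {n m : ℕ} {M : Type*} [TopologicalSpace M] [ChartedSpace (EuclideanSpace ℝ (Fin n)) M]
  [IsManifold (𝓡 n) ∞ M] {ι : M → EuclideanSpace ℝ (Fin m)} {f : M → ℝ} {x : M}
  {g : RiemMetric n M} {e : Fin n → VField n M} {U : Set M}

namespace RiemMetric.IsOrthonormalFrameOn

theorem smoothFieldAt (he : g.IsOrthonormalFrameOn e U) (hx : x ∈ U) (i : Fin n) :
    SmoothFieldAt (e i) x :=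
  (he.smooth i).contMDiffAt (he.isOpen.mem_nhds hx)

theorem sum_inner_smul (he : g.IsOrthonormalFrameOn e U) (hx : x ∈ U)
    (v : TangentSpace (𝓡 n) x) : ∑ i, g.inner x v (e i x) • e i x = v := by
  have hli : LinearIndependent ℝ fun i => e i x := by
    rw [Fintype.linearIndependent_iff]
    intro a ha i
    have h := congrArg (fun w => g.inner x (e i x) w) ha
    simpa [he.orthonormal x hx] using h
  have hcard : Fintype.card (Fin n) = Module.finrank ℝ (TangentSpace (𝓡 n) x) := by
    rw [Fintype.card_fin]
    exact (finrank_euclideanSpace_fin (𝕜 := ℝ)).symm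
  have hspan := hli.span_eq_top_of_card_eq_finrank' hcard
  have hv : v ∈ Submodule.span ℝ (Set.range fun i => e i x) := hspan ▸ Submodule.mem_top
  obtain ⟨c, rfl⟩ := (Submodule.mem_span_range_iff_exists_fun ℝ).1 hv
  refine Finset.sum_congr rfl fun i _ => ?_
  rw [g.symm x]
  simp [he.orthonormal x hx]

theorem sum_inner_mul (he : g.IsOrthonormalFrameOn e U) (hx : x ∈ U)
    (L : TangentSpace (𝓡 n) x →ₗ[ℝ] ℝ) (v : TangentSpace (𝓡 n) x) :
    ∑ i, g.inner x v (e i x) * L (e i x) = L v := by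
  conv_rhs => rw [← he.sum_inner_smul hx v, map_sum]
  simp only [map_smul, smul_eq_mul]

end RiemMetric.IsOrthonormalFrameOn

namespace IsConformalImmersion

/-- Contraction of `Π(A, ·)` with a tangent vector along an orthonormal frame. -/
theorem sum_inner_tensorPi (hι : IsConformalImmersion g ι f) (hf : SmoothAt n f x)
    (he : g.IsOrthonormalFrameOn e U) (hx : x ∈ U) {A : VField n M} (hA : SmoothFieldAt A x)
    (v : TangentSpace (𝓡 n) x) (w : EuclideanSpace ℝ (Fin m)) :
    ∑ i, g.inner x v (e i x) * ⟪tensorPi ι f A (e i) x, w⟫_ℝ = ⟪tensorPiAt ι f A x v, w⟫_ℝ := by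
  rw [real_inner_comm]
  refine Eq.trans (Finset.sum_congr rfl fun i _ => ?_)
    (he.sum_inner_mul hx ((innerₗ _ w) ∘ₗ (tensorPiAt ι f A x).toLinearMap) v)
  rw [hι.tensorPi_comm hf hA (he.smoothFieldAt hx i), tensorPi_eq, real_inner_comm]
  rfl

/-- The tangential part of `∂_B μ` is minus the shape operator, `⟨∂_B μ, T e_i⟩ = -⟨Π(B, e_i), μ⟩`
for `T = e^{-f} dι`. -/
theorem sum_tensorPi_mul_tensorPi (hι : IsConformalImmersion g ι f) (hf : SmoothAt n f x)
    (he : g.IsOrthonormalFrameOn e U) (hx : x ∈ U) {A : VField n M} (hA : SmoothFieldAt A x)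
    (B : VField n M) {μ : M → EuclideanSpace ℝ (Fin m)} (hμ : SmoothAt n μ x)
    (hμN : ∀ y, μ y ∈ normalSpace (n := n) ι y) (w : EuclideanSpace ℝ (Fin m)) :
    ∑ i, ⟪tensorPi ι f B (e i) x, μ x⟫_ℝ * ⟪tensorPi ι f A (e i) x, w⟫_ℝ
      = -⟪tensorPi ι f (tangentPart g ι f (dirDeriv B μ)) A x, w⟫_ℝ := by
  rw [tensorPi_eq, ← hι.sum_inner_tensorPi hf he hx hA, ← Finset.sum_neg_distrib]
  refine Finset.sum_congr rfl fun i _ => ?_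
  have h := hι.inner_dirDeriv_normal hf B (he.smoothFieldAt hx i) hμ hμN
  rw [inner_tangentPart]
  change _ = -(⟪dirDeriv B μ x, push ι f (e i) x⟫_ℝ * _)
  rw [h, real_inner_comm]
  ring

/-- For a vector field `B`, the tensor `tensorB` in the direction `B` is the scalar product with
`∇_B ∇f - df(B) ∇f + ½ |∇f|² B`; the frame contracts it into `Π(A, ·)`. -/
theorem sum_tensorPi_mul_tensorB (hι : IsConformalImmersion g ι f) (hf : SmoothAt n f x)
    (he : g.IsOrthonormalFrameOn e U) (hx : x ∈ U) {A B : VField n M} (hA : SmoothFieldAt A x)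
    (hB : SmoothFieldAt B x) (w : EuclideanSpace ℝ (Fin m)) :
    ∑ i, ⟪tensorPi ι f A (e i) x, w⟫_ℝ * tensorB g f B (e i) x
      = ⟪tensorPi ι f (g.leviCivita B (g.gradient f)) A x, w⟫_ℝ
        - dirDeriv B f x * ⟪tensorD g ι f A x, w⟫_ℝ
        + (1 / 2 : ℝ) * g.pair (g.gradient f) (g.gradient f) x * ⟪tensorPi ι f B A x, w⟫_ℝ := by
  change _ = _ - _ * ⟪tensorPi ι f (g.gradient f) A x, w⟫_ℝ + _
  rw [tensorPi_eq, tensorPi_eq, tensorPi_eq, ← hι.sum_inner_tensorPi hf he hx hA,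
    ← hι.sum_inner_tensorPi hf he hx hA, ← hι.sum_inner_tensorPi hf he hx hA, Finset.mul_sum,
    Finset.mul_sum, ← Finset.sum_sub_distrib, ← Finset.sum_add_distrib]
  refine Finset.sum_congr rfl fun i _ => ?_
  have h1 : g.pair (g.gradient f) (e i) x = dirDeriv (e i) f x :=
    congrFun (g.pair_gradient f (e i)) x
  simp only [tensorB, Pi.add_apply, Pi.sub_apply, Pi.mul_apply, Pi.smul_apply, smul_eq_mul,
    hι.hessian_eq hf hB (he.smoothFieldAt hx i), ← h1]
  simp only [RiemMetric.pair]
  ring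

/-- The covariant derivative of `D_♭`, expressed through that of `Π(·, ∇f)`. -/
theorem nablaDFlat_eq (hι : IsConformalImmersion g ι f) (hf : ∀ x, SmoothAt n f x)
    {X Y : VField n M} (hX : SmoothField X) (hY : SmoothField Y)
    {μ : M → EuclideanSpace ℝ (Fin m)} (hμ : IsNormalSection (n := n) ι μ) (x : M) :
    nablaDFlat g ι f X Y μ x = ⟪nablaPi g ι f X Y (g.gradient f) x, μ x⟫_ℝ
      + ⟪tensorPi ι f (g.leviCivita X (g.gradient f)) Y x, μ x⟫_ℝ := by
  have hgr : SmoothField (g.gradient f) := fun y => hι.smoothFieldAt_gradient (hf y)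
  have h1 : tensorDFlat g ι f Y μ = fun y => ⟪tensorPi ι f Y (g.gradient f) y, μ y⟫_ℝ := by
    funext y
    rw [hι.tensorPi_comm (hf y) (hY y) (hgr y)]
    rfl
  have h2 := dirDeriv_inner_normal (X := X) (hι.smoothAt_tensorPi (hf x) (hY x) (hgr x))
    (hμ.smooth x) (tensorPi_mem Y (g.gradient f)) (hμ.mem x)
  have h3 : tensorDFlat g ι f (g.leviCivita X Y) μ x
      = ⟪tensorPi ι f (g.leviCivita X Y) (g.gradient f) x, μ x⟫_ℝ := by
    rw [hι.tensorPi_comm (hf x) (hι.smoothField_leviCivita hf hX hY x) (hgr x)]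
    rfl
  have h4 : tensorDFlat g ι f Y (normalConnection ι X μ) x
      = ⟪tensorPi ι f Y (g.gradient f) x, normalConnection ι X μ x⟫_ℝ := by
    rw [hι.tensorPi_comm (hf x) (hY x) (hgr x)]
    rfl
  simp only [nablaDFlat, nablaPi, covDerivTensor, Pi.sub_apply, inner_sub_left]
  rw [h1, h2, h3, h4, hι.tensorPi_comm (hf x) (hY x) (hι.smoothField_leviCivita hf hX hgr x)]
  ring

end IsConformalImmersion

end Frame

end ConformalImmersion

end

theorem theorem5p3 {n m : ℕ} {M : Type*} [TopologicalSpace M]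
    [ChartedSpace (EuclideanSpace ℝ (Fin n)) M] [IsManifold (𝓡 n) ∞ M]
    (g : RiemMetric n M) (ι : M → EuclideanSpace ℝ (Fin m)) (f : M → ℝ)
    (hf : ContMDiff (𝓡 n) 𝓘(ℝ, ℝ) ∞ f) (hι : IsConformalImmersion g ι f)
    (X Y Z W : VField n M)
    (hX : SmoothField X) (hY : SmoothField Y) (hZ : SmoothField Z) (hW : SmoothField W)
    (μ ν : M → EuclideanSpace ℝ (Fin m))
    (hμ : IsNormalSection (n := n) ι μ) (hν : IsNormalSection (n := n) ι ν)
    (e : Fin n → VField n M) (U : Set M) (he : g.IsOrthonormalFrameOn e U) :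
    -- Gauss equation
    (∀ x, g.inner x ((totalCurvature g ι X Y (Z, 0)).1 x) (W x)
        - ⟪tensorPi ι f Y Z x, tensorPi ι f X W x⟫_ℝ
        + ⟪tensorPi ι f X Z x, tensorPi ι f Y W x⟫_ℝ
      = -kulkarniNomizu g.pair (tensorB g f) X Y Z W x) ∧
    -- Codazzi equation
    (∀ x, nablaPi g ι f X Y Z x - nablaPi g ι f Y X Z x
      = g.pair Y Z x • tensorD g ι f X x - g.pair X Z x • tensorD g ι f Y x) ∧
    -- Ricci equation
    (∀ x ∈ U, ⟪(totalCurvature g ι X Y (0, μ)).2 x, ν x⟫_ℝ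
        + ∑ i, ⟪tensorPi ι f X (e i) x, μ x⟫_ℝ * ⟪tensorPi ι f Y (e i) x, ν x⟫_ℝ
        - ∑ i, ⟪tensorPi ι f X (e i) x, ν x⟫_ℝ * ⟪tensorPi ι f Y (e i) x, μ x⟫_ℝ = 0) ∧
    -- the two equations of the form "symmetric in X, Y"
    (∀ x, nablaB g f X Y Z x + ⟪tensorD g ι f X x, tensorPi ι f Y Z x⟫_ℝ
      = nablaB g f Y X Z x + ⟪tensorD g ι f Y x, tensorPi ι f X Z x⟫_ℝ) ∧
    (∀ x ∈ U, nablaDFlat g ι f X Y μ x + ∑ i, ⟪tensorPi ι f X (e i) x, μ x⟫_ℝ * tensorB g f Y (e i) x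
      = nablaDFlat g ι f Y X μ x
        + ∑ i, ⟪tensorPi ι f Y (e i) x, μ x⟫_ℝ * tensorB g f X (e i) x) := by
  have hx : ∀ x, SmoothAt n f x := fun x => hf x
  have hgr : SmoothField (g.gradient f) := fun y => hι.smoothFieldAt_gradient (hx y)
  refine ⟨fun x => ?_, hι.codazzi hx hX hY hZ, fun x hxU => ?_, hι.nablaB_add_inner hx hX hY hZ,
    fun x hxU => ?_⟩
  · rw [← hι.gauss hx hX hY hZ hW x]
    congr 2
    change g.inner x (_ - _ - _) _ = _
    rw [map_sub, map_sub]
    rfl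
  · have h := hι.ricci hx hX hY (fun x => hμ.smooth x) (hν.mem x)
    change ⟪curvature (normalConnection ι) X Y μ x, ν x⟫_ℝ + _ - _ = 0
    have hs := hι.sum_tensorPi_mul_tensorPi (hx x) he hxU (hX x) Y (hμ.smooth x) hμ.mem (ν x)
    simp only [mul_comm ⟪tensorPi ι f Y (e _) x, μ x⟫_ℝ] at hs
    rw [h, hι.sum_tensorPi_mul_tensorPi (hx x) he hxU (hY x) X (hμ.smooth x) hμ.mem, hs]
    ring
  -- The difference of the two sides is the Codazzi equation for `∇f`, paired with `μ`: the term
  -- `½ |∇f|² Π(X, Y)` of the contraction cancels by symmetry.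
  · have hc := congrArg (fun u => ⟪u, μ x⟫_ℝ) (hι.codazzi hx hX hY hgr x)
    simp only [inner_sub_left, real_inner_smul_left, g.pair_comm _ (g.gradient f),
      g.pair_gradient] at hc
    rw [hι.sum_tensorPi_mul_tensorB (hx x) he hxU (hX x) (hY x),
      hι.sum_tensorPi_mul_tensorB (hx x) he hxU (hY x) (hX x),
      hι.nablaDFlat_eq hx hX hY hμ, hι.nablaDFlat_eq hx hY hX hμ,
      hι.tensorPi_comm (hx x) (hY x) (hX x)]
    linear_combination hc
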